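/- Equip $\{-1,1\}^n$ with the uniform distribution. For $\rho\in[-1,1]$ and $x\in\{-1,1\}^n$, a $\rho$-correlated copy of $x$ is a random string $y\in\{-1,1\}^n$ whose coordinates are independent, with $y_i=x_i$ with probability $\frac12(1+\rho)$ and $y_i=-x_i$ with probability $\frac12(1-\rho)$. For $f:\{-1,1\}^n\to\mathbb{R}$ put $T_\rho f(x)=\mathbf{E}[f(y)]$, where $y$ is a $\rho$-correlated copy of $x$, and $\mathrm{Stab}_\rho[f]=\mathbf{E}_x[f(x)\,T_\rho f(x)]$, where $x$ is uniform. For $1\le i\le n$ let $\mathrm{D}_if(x)=\frac12\bigl(f(x_1,\dots,x_{i-1},1,x_{i+1},\dots,x_n)-f(x_1,\dots,x_{i-1},-1,x_{i+1},\dots,x_n)\bigr)$ and $\mathrm{Inf}_i[f]=\mathbf{E}_x[\mathrm{D}_if(x)^2]$. **Majority Is Stablest Theorem.** 1. For every $0<\rho<1$ there is a function $e_\rho:(0,\infty)\to\mathbb{R}$ with $e_\rho(\varepsilon)\to0$ as $\varepsilon\to0^+$ such that for every $\varepsilon>0$, every $n$ and every $f:\{-1,1\}^n\to[-1,1]$ with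 $\mathbf{E}[f]=0$ and $\max_i\mathrm{Inf}_i[f]\le\varepsilon$, $$\mathrm{Stab}_\rho[f]\le 1-\tfrac{2}{\pi}\arccos\rho+e_\rho(\varepsilon).$$ 2. For every $-1<\rho<0$ there is a function $e_\rho:(0,\infty)\to\mathbb{R}$ with $e_\rho(\varepsilon)\to0$ as $\varepsilon\to0^+$ such that for every $\varepsilon>0$, every $n$ and every $f:\{-1,1\}^n\to[-1,1]$ (of any mean) with $\max_i\mathrm{Inf}_i[f]\le\varepsilon$, $$\mathrm{Stab}_\rho[f]\ge 1-\tfrac{2}{\pi}\arccos\rho+e_\rho(\varepsilon).$$ -/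

import Mathlib

open Filter
open scoped BigOperators Topology

namespace BooleanCube

noncomputable section

/-- The discrete cube `{-1,1}^n`; the type `ℤˣ` of units of `ℤ` consists of exactly `1` and `-1`. -/
abbrev Cube (n : ℕ) : Type := Fin n → ℤˣ

/-- The expectation of `f` at a uniformly random point of the cube. -/
def mean {n : ℕ} (f : Cube n → ℝ) : ℝ := 𝔼 x : Cube n, f x

/-- The probability that a `ρ`-correlated copy of `x` equals `y`: independently for each `i`,
the `i`th coordinate is `x i` with probability `(1 + ρ) / 2` and `-x i` with probability
`(1 - ρ) / 2`. -/
def copyProb {n : ℕ} (ρ : ℝ) (x y : Cube n) : ℝ :=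
  ∏ i, if y i = x i then (1 + ρ) / 2 else (1 - ρ) / 2

/-- The noise operator: `noiseOp ρ f x` is the expectation of `f y` for `y` a `ρ`-correlated
copy of `x`. -/
def noiseOp {n : ℕ} (ρ : ℝ) (f : Cube n → ℝ) (x : Cube n) : ℝ :=
  ∑ y : Cube n, copyProb ρ x y * f y

/-- The noise stability of `f` at `ρ`. -/
def stab {n : ℕ} (ρ : ℝ) (f : Cube n → ℝ) : ℝ :=
  mean fun x => f x * noiseOp ρ f x

/-- The discrete `i`th derivative. -/
def discreteDeriv {n : ℕ} (i : Fin n) (f : Cube n → ℝ) (x : Cube n) : ℝ :=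
  (f (Function.update x i 1) - f (Function.update x i (-1))) / 2

/-- The `i`th influence. -/
def influence {n : ℕ} (i : Fin n) (f : Cube n → ℝ) : ℝ :=
  mean fun x => discreteDeriv i f x ^ 2

end

end BooleanCube

/-! Let J(x, y) = `stabFun ρ x y` be the probability that a `ρ`-correlated normal pair lies below
the quantiles of `x` and `y`. For `0 ≤ ρ < 1` it has three decisive properties: J(x, y) ≥ xy
(`mul_le_stabFun`), J(1/2, 1/2) = 1/4 + arcsin ρ / (2π) (`stabFun_half`), and averaging J over one
`ρ`-correlated pair of signs around (x, y) increases it by at most a cubic error in the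
displacements (`exists_stabFun_two_point`). The last holds because the sign-averaged Hessian form of
J is minus ρ times a positive multiple of a square.

Induction on the dimension (`pairMean_le_of_two_point`) turns the two-point inequality into E
J(F(x), F(y)) ≤ J(E F, E F) + error, the error being a constant times the summed third moments of
the discrete derivatives. For `F` with values in [δ, 1 - δ] and mean 1/2 this gives Stab[F] ≤ 1/4 +
arcsin ρ / (2π) + error, which is the claim after an affine change of range.

To make the error small, `f` is replaced by T_s T_s f. One smoothing bounds the total influence
independently of `n`. For the other, Bonami's inequality on the low-degree part and decay of the
high-degree part make each third moment a small multiple of the corresponding influence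
(`exists_sum_mean_abs_deriv_cube_le`). The price is that J is used at ρ / s⁴, harmless for s near 1.

For negative `ρ`, a (-ρ)-correlated copy is the negation of a ρ-correlated one, so only the part of
`f` odd under x ↦ -x can make the stability negative. That part has mean zero, and the positive case
applies to it. -/

namespace BooleanCube

noncomputable section

/-! ### Splitting off the first coordinate -/

/-- The part of `f` that does not depend on the first coordinate. -/
def evenPart {n : ℕ} (f : Cube (n + 1) → ℝ) (x : Cube n) : ℝ :=
  (f (Fin.cons 1 x) + f (Fin.cons (-1) x)) / 2

/-- The coefficient of the first coordinate in `f`. -/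
def oddPart {n : ℕ} (f : Cube (n + 1) → ℝ) (x : Cube n) : ℝ :=
  (f (Fin.cons 1 x) - f (Fin.cons (-1) x)) / 2

variable {n : ℕ}

theorem cons_one_eq (f : Cube (n + 1) → ℝ) (x : Cube n) :
    f (Fin.cons 1 x) = evenPart f x + oddPart f x := by
  unfold evenPart oddPart; ring

theorem cons_neg_one_eq (f : Cube (n + 1) → ℝ) (x : Cube n) :
    f (Fin.cons (-1) x) = evenPart f x - oddPart f x := by
  unfold evenPart oddPart; ring

theorem forall_cube_succ {P : Cube (n + 1) → Prop} :
    (∀ z, P z) ↔ (∀ x, P (Fin.cons 1 x)) ∧ ∀ x, P (Fin.cons (-1) x) := by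
  refine ⟨fun h => ⟨fun x => h _, fun x => h _⟩, fun h z => ?_⟩
  rw [← Fin.cons_self_tail z]
  rcases Int.units_eq_one_or (z 0) with h0 | h0 <;> rw [h0]
  exacts [h.1 _, h.2 _]

theorem ext_parts {f g : Cube (n + 1) → ℝ} (he : evenPart f = evenPart g)
    (ho : oddPart f = oddPart g) : f = g := by
  funext z
  revert z
  rw [forall_cube_succ]
  simp only [cons_one_eq, cons_neg_one_eq, he, ho, implies_true, and_self]

theorem sum_cube_succ (f : Cube (n + 1) → ℝ) :
    ∑ z, f z = (∑ x, f (Fin.cons 1 x)) + ∑ x, f (Fin.cons (-1) x) := by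
  rw [← (Fin.consEquiv (fun _ : Fin (n + 1) => ℤˣ)).sum_comp, Fintype.sum_prod_type]
  have : (Finset.univ : Finset ℤˣ) = {1, -1} := by decide
  rw [this, Finset.sum_pair (by decide)]
  rfl

/-! ### The mean -/

theorem mean_eq_sum (f : Cube n → ℝ) : mean f = (∑ x, f x) / 2 ^ n := by
  unfold mean
  rw [Fintype.expect_eq_sum_div_card]
  simp

theorem mean_succ (f : Cube (n + 1) → ℝ) :
    mean f = (mean (fun x => f (Fin.cons 1 x)) + mean (fun x => f (Fin.cons (-1) x))) / 2 := by
  simp only [mean_eq_sum, sum_cube_succ, pow_succ]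
  field_simp

theorem mean_zero (f : Cube 0 → ℝ) (x : Cube 0) : mean f = f x := by
  rw [mean_eq_sum, Fintype.sum_unique, pow_zero, div_one]
  exact congrArg f (Subsingleton.elim _ _)

theorem mean_add (f g : Cube n → ℝ) : mean (fun x => f x + g x) = mean f + mean g :=
  Finset.expect_add_distrib _ _ _

theorem mean_sub (f g : Cube n → ℝ) : mean (fun x => f x - g x) = mean f - mean g :=
  Finset.expect_sub_distrib _ _ _

theorem mean_const_mul (c : ℝ) (f : Cube n → ℝ) : mean (fun x => c * f x) = c * mean f :=
  (Finset.mul_expect _ _ _).symm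

theorem mean_const (c : ℝ) : mean (fun _ : Cube n => c) = c := Fintype.expect_const c

theorem mean_mono {f g : Cube n → ℝ} (h : ∀ x, f x ≤ g x) : mean f ≤ mean g :=
  Finset.expect_le_expect fun x _ => h x

theorem mean_nonneg {f : Cube n → ℝ} (h : ∀ x, 0 ≤ f x) : 0 ≤ mean f :=
  Finset.expect_nonneg fun x _ => h x

theorem mean_comp_equiv (e : Cube n ≃ Cube n) (f : Cube n → ℝ) :
    mean (fun x => f (e x)) = mean f :=
  Fintype.expect_equiv e _ _ fun _ => rfl

theorem mean_parts (f : Cube (n + 1) → ℝ) : mean f = mean (evenPart f) := by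
  rw [mean_succ]
  simp only [cons_one_eq, cons_neg_one_eq, mean_add, mean_sub]
  ring

theorem mean_mul_parts (f g : Cube (n + 1) → ℝ) :
    mean (fun x => f x * g x) = mean (fun x => evenPart f x * evenPart g x) +
      mean (fun x => oddPart f x * oddPart g x) := by
  rw [mean_parts, ← mean_add]
  congr 1
  funext x
  simp only [evenPart, oddPart]
  ring

theorem mean_sq_parts (f : Cube (n + 1) → ℝ) :
    mean (fun x => f x ^ 2) = mean (fun x => evenPart f x ^ 2) +
      mean (fun x => oddPart f x ^ 2) := by
  simpa only [sq] using mean_mul_parts f f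

theorem mean_pow_four_parts (f : Cube (n + 1) → ℝ) :
    mean (fun x => f x ^ 4) = mean (fun x => evenPart f x ^ 4) +
      6 * mean (fun x => evenPart f x ^ 2 * oddPart f x ^ 2) +
      mean (fun x => oddPart f x ^ 4) := by
  rw [mean_parts, ← mean_const_mul, ← mean_add, ← mean_add]
  congr 1
  funext x
  simp only [evenPart, oddPart]
  ring

theorem mean_sq_mul_le (f g : Cube n → ℝ) :
    mean (fun x => f x * g x) ^ 2 ≤ mean (fun x => f x ^ 2) * mean (fun x => g x ^ 2) :=
  Finset.expect_mul_sq_le_sq_mul_sq _ _ _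

/-- Jensen's inequality for the uniform distribution on the cube. -/
theorem map_mean_le {e : ℝ → ℝ} (he : ∀ a b, e ((a + b) / 2) ≤ (e a + e b) / 2) :
    ∀ {n : ℕ} (f : Cube n → ℝ), e (mean f) ≤ mean fun x => e (f x)
  | 0, f => by rw [mean_zero f default, mean_zero _ default]
  | n + 1, f => by
    rw [mean_succ f, mean_succ fun x => e (f x)]
    have h1 := map_mean_le he fun x => f (Fin.cons 1 x)
    have h2 := map_mean_le he fun x => f (Fin.cons (-1) x)
    linarith [he (mean fun x => f (Fin.cons 1 x)) (mean fun x => f (Fin.cons (-1) x))]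

/-! ### The noise operator -/

theorem noiseOp_add (ρ : ℝ) (f g : Cube n → ℝ) (x : Cube n) :
    noiseOp ρ (fun y => f y + g y) x = noiseOp ρ f x + noiseOp ρ g x := by
  simp only [noiseOp, mul_add, Finset.sum_add_distrib]

theorem noiseOp_sub (ρ : ℝ) (f g : Cube n → ℝ) (x : Cube n) :
    noiseOp ρ (fun y => f y - g y) x = noiseOp ρ f x - noiseOp ρ g x := by
  simp only [noiseOp, mul_sub, Finset.sum_sub_distrib]

theorem noiseOp_const_mul (ρ c : ℝ) (f : Cube n → ℝ) (x : Cube n) :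
    noiseOp ρ (fun y => c * f y) x = c * noiseOp ρ f x := by
  simp only [noiseOp, Finset.mul_sum]
  exact Finset.sum_congr rfl fun y _ => by ring

theorem noiseOp_zero (ρ : ℝ) (f : Cube 0 → ℝ) : noiseOp ρ f = f := by
  funext x
  rw [noiseOp, Fintype.sum_unique]
  simp only [copyProb, Finset.univ_eq_empty, Finset.prod_empty, one_mul]
  exact congrArg f (Subsingleton.elim _ _)

theorem copyProb_cons (ρ : ℝ) (u v : ℤˣ) (x y : Cube n) :
    copyProb ρ (Fin.cons u x : Cube (n + 1)) (Fin.cons v y) =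
      (if v = u then (1 + ρ) / 2 else (1 - ρ) / 2) * copyProb ρ x y := by
  simp [copyProb, Fin.prod_univ_succ]

theorem sum_copyProb_cons_one (ρ : ℝ) (F : Cube (n + 1) → ℝ) (x : Cube n) :
    ∑ z, copyProb ρ (Fin.cons 1 x) z * F z =
      (1 + ρ) / 2 * ∑ y, copyProb ρ x y * F (Fin.cons 1 y) +
        (1 - ρ) / 2 * ∑ y, copyProb ρ x y * F (Fin.cons (-1) y) := by
  have h : ¬ ((-1 : ℤˣ) = 1) := by decide
  simp only [sum_cube_succ, copyProb_cons, if_true, if_neg h, Finset.mul_sum, mul_assoc]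

theorem sum_copyProb_cons_neg_one (ρ : ℝ) (F : Cube (n + 1) → ℝ) (x : Cube n) :
    ∑ z, copyProb ρ (Fin.cons (-1) x) z * F z =
      (1 - ρ) / 2 * ∑ y, copyProb ρ x y * F (Fin.cons 1 y) +
        (1 + ρ) / 2 * ∑ y, copyProb ρ x y * F (Fin.cons (-1) y) := by
  have h : ¬ ((1 : ℤˣ) = -1) := by decide
  simp only [sum_cube_succ, copyProb_cons, if_true, if_neg h, Finset.mul_sum, mul_assoc]

theorem noiseOp_cons_one (ρ : ℝ) (f : Cube (n + 1) → ℝ) (x : Cube n) :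
    noiseOp ρ f (Fin.cons 1 x) = noiseOp ρ (evenPart f) x + ρ * noiseOp ρ (oddPart f) x := by
  have h := sum_copyProb_cons_one ρ f x
  have he := noiseOp_add ρ (evenPart f) (oddPart f) x
  have ho := noiseOp_sub ρ (evenPart f) (oddPart f) x
  simp only [cons_one_eq, cons_neg_one_eq] at h
  simp only [noiseOp] at he ho ⊢
  rw [h, he, ho]
  ring

theorem noiseOp_cons_neg_one (ρ : ℝ) (f : Cube (n + 1) → ℝ) (x : Cube n) :
    noiseOp ρ f (Fin.cons (-1) x) = noiseOp ρ (evenPart f) x - ρ * noiseOp ρ (oddPart f) x := by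
  have h := sum_copyProb_cons_neg_one ρ f x
  have he := noiseOp_add ρ (evenPart f) (oddPart f) x
  have ho := noiseOp_sub ρ (evenPart f) (oddPart f) x
  simp only [cons_one_eq, cons_neg_one_eq] at h
  simp only [noiseOp] at he ho ⊢
  rw [h, he, ho]
  ring

/-- Together with `oddPart_noiseOp` this is the inductive substitute for T_ρ χ_S = ρ^|S| χ_S: each
coordinate present in a monomial contributes one factor `ρ`. -/
theorem evenPart_noiseOp (ρ : ℝ) (f : Cube (n + 1) → ℝ) :
    evenPart (noiseOp ρ f) = noiseOp ρ (evenPart f) := by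
  funext x
  rw [evenPart, noiseOp_cons_one, noiseOp_cons_neg_one]
  ring

theorem oddPart_noiseOp (ρ : ℝ) (f : Cube (n + 1) → ℝ) :
    oddPart (noiseOp ρ f) = fun x => ρ * noiseOp ρ (oddPart f) x := by
  funext x
  rw [oddPart, noiseOp_cons_one, noiseOp_cons_neg_one]
  ring

theorem noiseOp_noiseOp (a b : ℝ) : ∀ {n : ℕ} (f : Cube n → ℝ),
    noiseOp a (noiseOp b f) = noiseOp (a * b) f
  | 0, f => by simp only [noiseOp_zero]
  | n + 1, f => by
    apply ext_parts
    · simp only [evenPart_noiseOp, noiseOp_noiseOp a b (evenPart f)]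
    · simp only [oddPart_noiseOp]
      funext x
      rw [noiseOp_const_mul, noiseOp_noiseOp a b (oddPart f)]
      ring

theorem mean_noiseOp (ρ : ℝ) : ∀ {n : ℕ} (f : Cube n → ℝ), mean (noiseOp ρ f) = mean f
  | 0, f => by rw [noiseOp_zero]
  | n + 1, f => by rw [mean_parts, evenPart_noiseOp, mean_noiseOp ρ (evenPart f), mean_parts f]

theorem mean_mul_noiseOp_comm (ρ : ℝ) : ∀ {n : ℕ} (f g : Cube n → ℝ),
    mean (fun x => f x * noiseOp ρ g x) = mean (fun x => noiseOp ρ f x * g x)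
  | 0, f, g => by simp only [noiseOp_zero]
  | n + 1, f, g => by
    simp only [mean_mul_parts, evenPart_noiseOp, oddPart_noiseOp]
    rw [mean_mul_noiseOp_comm ρ (evenPart f)]
    congr 1
    simp only [mul_left_comm _ ρ, mul_assoc, mean_const_mul, mean_mul_noiseOp_comm ρ (oddPart f)]

/-- Self-adjointness and the semigroup law let smoothing of the function be traded for a change of
the correlation parameter. -/
theorem stab_noiseOp (ρ r : ℝ) (f : Cube n → ℝ) :
    stab ρ (noiseOp r f) = stab (r * ρ * r) f := by
  unfold stab
  rw [← mean_mul_noiseOp_comm, noiseOp_noiseOp, noiseOp_noiseOp, mul_assoc]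

theorem copyProb_nonneg {ρ : ℝ} (h1 : -1 ≤ ρ) (h2 : ρ ≤ 1) (x y : Cube n) :
    0 ≤ copyProb ρ x y :=
  Finset.prod_nonneg fun i _ => by split_ifs <;> linarith

theorem sum_copyProb (ρ : ℝ) : ∀ {n : ℕ} (x : Cube n), ∑ y, copyProb ρ x y = 1
  | 0, x => by simp [copyProb]
  | n + 1, x => by
    revert x
    rw [forall_cube_succ]
    refine ⟨fun x => ?_, fun x => ?_⟩
    · have h := sum_copyProb_cons_one ρ (fun _ => 1) x
      simp only [mul_one] at h
      rw [h, sum_copyProb ρ x]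
      ring
    · have h := sum_copyProb_cons_neg_one ρ (fun _ => 1) x
      simp only [mul_one] at h
      rw [h, sum_copyProb ρ x]
      ring

theorem noiseOp_const (ρ c : ℝ) (x : Cube n) : noiseOp ρ (fun _ => c) x = c := by
  rw [noiseOp, ← Finset.sum_mul, sum_copyProb, one_mul]

theorem noiseOp_mem_Icc {ρ : ℝ} (h1 : -1 ≤ ρ) (h2 : ρ ≤ 1) {a b : ℝ} {f : Cube n → ℝ}
    (hf : ∀ x, f x ∈ Set.Icc a b) (x : Cube n) : noiseOp ρ f x ∈ Set.Icc a b := by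
  constructor
  · rw [← noiseOp_const ρ a x]
    exact Finset.sum_le_sum fun y _ =>
      mul_le_mul_of_nonneg_left (hf y).1 (copyProb_nonneg h1 h2 x y)
  · rw [← noiseOp_const ρ b x]
    exact Finset.sum_le_sum fun y _ =>
      mul_le_mul_of_nonneg_left (hf y).2 (copyProb_nonneg h1 h2 x y)

theorem mean_noiseOp_sq_le {s : ℝ} (hs : s ^ 2 ≤ 1) : ∀ {n : ℕ} (f : Cube n → ℝ),
    mean (fun x => noiseOp s f x ^ 2) ≤ mean (fun x => f x ^ 2)
  | 0, f => by rw [noiseOp_zero]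
  | n + 1, f => by
    simp only [mean_sq_parts, evenPart_noiseOp, oddPart_noiseOp, mul_pow, mean_const_mul]
    have h1 := mean_noiseOp_sq_le hs (evenPart f)
    have h2 := mean_noiseOp_sq_le hs (oddPart f)
    have h3 : 0 ≤ mean (fun x => noiseOp s (oddPart f) x ^ 2) := mean_nonneg fun x => sq_nonneg _
    nlinarith

/-! ### Discrete derivatives -/

theorem discreteDeriv_zero (f : Cube (n + 1) → ℝ) (u : ℤˣ) (x : Cube n) :
    discreteDeriv 0 f (Fin.cons u x) = oddPart f x := by
  simp [discreteDeriv, oddPart, Fin.update_cons_zero]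

theorem discreteDeriv_succ (f : Cube (n + 1) → ℝ) (j : Fin n) (u : ℤˣ) (x : Cube n) :
    discreteDeriv j.succ f (Fin.cons u x) = discreteDeriv j (fun y => f (Fin.cons u y)) x := by
  simp [discreteDeriv, ← Fin.cons_update]

theorem evenPart_discreteDeriv_zero (f : Cube (n + 1) → ℝ) :
    evenPart (discreteDeriv 0 f) = oddPart f := by
  funext x
  simp [evenPart, discreteDeriv_zero]

theorem oddPart_discreteDeriv_zero (f : Cube (n + 1) → ℝ) :
    oddPart (discreteDeriv 0 f) = fun _ => 0 := by
  funext x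
  simp [oddPart, discreteDeriv_zero]

theorem evenPart_discreteDeriv_succ (f : Cube (n + 1) → ℝ) (j : Fin n) :
    evenPart (discreteDeriv j.succ f) = discreteDeriv j (evenPart f) := by
  funext x
  rw [evenPart, discreteDeriv_succ, discreteDeriv_succ]
  simp only [evenPart, discreteDeriv]
  ring

theorem oddPart_discreteDeriv_succ (f : Cube (n + 1) → ℝ) (j : Fin n) :
    oddPart (discreteDeriv j.succ f) = discreteDeriv j (oddPart f) := by
  funext x
  rw [oddPart, discreteDeriv_succ, discreteDeriv_succ]
  simp only [oddPart, discreteDeriv]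
  ring

theorem discreteDeriv_const_mul (i : Fin n) (c : ℝ) (f : Cube n → ℝ) (x : Cube n) :
    discreteDeriv i (fun y => c * f y) x = c * discreteDeriv i f x := by
  simp only [discreteDeriv]
  ring

theorem discreteDeriv_noiseOp (s : ℝ) : ∀ {n : ℕ} (i : Fin n) (f : Cube n → ℝ),
    discreteDeriv i (noiseOp s f) = fun x => s * noiseOp s (discreteDeriv i f) x
  | 0, i, _ => i.elim0
  | n + 1, i, f => by
    have hT : ∀ g : Cube (n + 1) → ℝ, evenPart (fun x => s * g x) = fun x => s * evenPart g x :=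
      fun g => by funext x; simp only [evenPart]; ring
    have hT' : ∀ g : Cube (n + 1) → ℝ, oddPart (fun x => s * g x) = fun x => s * oddPart g x :=
      fun g => by funext x; simp only [oddPart]; ring
    induction i using Fin.cases with
    | zero =>
      apply ext_parts
      · rw [evenPart_discreteDeriv_zero, oddPart_noiseOp, hT, evenPart_noiseOp,
          evenPart_discreteDeriv_zero]
      · rw [oddPart_discreteDeriv_zero, hT', oddPart_noiseOp, oddPart_discreteDeriv_zero]
        simp only [noiseOp_const, mul_zero]
    | succ j =>
      apply ext_parts
      · rw [evenPart_discreteDeriv_succ, evenPart_noiseOp, hT, evenPart_noiseOp,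
          evenPart_discreteDeriv_succ, discreteDeriv_noiseOp s j]
      · rw [oddPart_discreteDeriv_succ, oddPart_noiseOp, hT', oddPart_noiseOp,
          oddPart_discreteDeriv_succ]
        funext x
        rw [discreteDeriv_const_mul, discreteDeriv_noiseOp s j]

theorem abs_discreteDeriv_le {f : Cube n → ℝ} (hf : ∀ x, f x ∈ Set.Icc (-1 : ℝ) 1) (i : Fin n)
    (x : Cube n) : |discreteDeriv i f x| ≤ 1 := by
  have h1 := hf (Function.update x i 1)
  have h2 := hf (Function.update x i (-1))
  rw [discreteDeriv, abs_le]
  constructor <;> linarith [h1.1, h1.2, h2.1, h2.2]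

/-- The total influence of a smoothed function is bounded independently of the dimension. -/
theorem sum_influence_noiseOp_add_le {s : ℝ} (hs : s ^ 2 ≤ 1) : ∀ {n : ℕ} (f : Cube n → ℝ),
    (1 - s ^ 2) * ∑ i, influence i (noiseOp s f) + s ^ 2 * mean (fun x => noiseOp s f x ^ 2) ≤
      s ^ 2 * mean (fun x => f x ^ 2)
  | 0, f => by simp [noiseOp_zero]
  | n + 1, f => by
    -- The second term on the left is what closes the induction. In Fourier terms, with q = s², the
    -- claim at degree k reads (1 - q) k q^k + q^(k+1) ≤ q, with equality at k = 0 and k = 1.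
    have h1 := sum_influence_noiseOp_add_le hs (evenPart f)
    have h2 := sum_influence_noiseOp_add_le hs (oddPart f)
    have h3 := mean_noiseOp_sq_le hs (oddPart f)
    have h4 : ∀ j : Fin n, influence j.succ (noiseOp s f) =
        influence j (noiseOp s (evenPart f)) + s ^ 2 * influence j (noiseOp s (oddPart f)) := by
      intro j
      simp only [influence]
      rw [mean_sq_parts, evenPart_discreteDeriv_succ, oddPart_discreteDeriv_succ,
        evenPart_noiseOp, oddPart_noiseOp]
      simp only [discreteDeriv_const_mul, mul_pow, mean_const_mul]
    have h5 : influence 0 (noiseOp s f) = s ^ 2 * mean (fun x => noiseOp s (oddPart f) x ^ 2) := by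
      simp only [influence]
      rw [mean_sq_parts, evenPart_discreteDeriv_zero, oddPart_discreteDeriv_zero, oddPart_noiseOp]
      simp only [mul_pow, mean_const_mul, mean_const]
      ring
    rw [Fin.sum_univ_succ, h5]
    simp only [h4, Finset.sum_add_distrib, ← Finset.mul_sum, mean_sq_parts, evenPart_noiseOp,
      oddPart_noiseOp, mul_pow, mean_const_mul]
    have h6 := mul_le_mul_of_nonneg_left h2 (sq_nonneg s)
    have h7 := mul_le_mul_of_nonneg_left h3 (mul_nonneg (sub_nonneg.2 hs) (sq_nonneg s))
    linear_combination h1 + h6 + h7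

/-! ### Hypercontractivity at low degree -/

/-- A smoothed function is the sum of a part with controlled fourth moment and a part with small
second moment. -/
theorem exists_low_add_high {s : ℝ} (hs : s ^ 2 ≤ 1) : ∀ {n : ℕ} (k : ℕ) (u : Cube n → ℝ),
    ∃ l h : Cube n → ℝ, (∀ x, noiseOp s u x = l x + h x) ∧
      mean (fun x => l x ^ 4) ≤ 9 ^ k * mean (fun x => u x ^ 2) ^ 2 ∧
      mean (fun x => h x ^ 2) ≤ (s ^ 2) ^ k * mean (fun x => u x ^ 2)
  -- `l` is the part of T_s u of degree less than `k`, and `h` the rest. For `k = 0` everything is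
  -- high. In the inductive step the odd part gets `k` in place of `k + 1`, because the first
  -- coordinate uses up one degree.
  | n, 0, u => by
    refine ⟨fun _ => 0, noiseOp s u, by simp, ?_, ?_⟩
    · simp only [ne_eq, OfNat.ofNat_ne_zero, not_false_eq_true, zero_pow, mean_const]
      positivity
    · simpa using mean_noiseOp_sq_le hs u
  | 0, k + 1, u => by
    refine ⟨u, fun _ => 0, by simp [noiseOp_zero], ?_, ?_⟩
    · rw [mean_zero _ default, mean_zero _ default]
      have : (1 : ℝ) ≤ 9 ^ (k + 1) := one_le_pow₀ (by norm_num)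
      nlinarith [sq_nonneg (u default ^ 2)]
    · rw [mean_zero _ default, mean_zero _ default, zero_pow two_ne_zero]
      positivity
  | n + 1, k + 1, u => by
    obtain ⟨l₀, h₀, e₀, a₀, b₀⟩ := exists_low_add_high hs (k + 1) (evenPart u)
    obtain ⟨l₁, h₁, e₁, a₁, b₁⟩ := exists_low_add_high hs k (oddPart u)
    let glue : (Cube n → ℝ) → (Cube n → ℝ) → Cube (n + 1) → ℝ :=
      fun p q z => p (Fin.tail z) + ((z 0 : ℤ) : ℝ) * (s * q (Fin.tail z))
    have ge : ∀ p q, evenPart (glue p q) = p := fun p q => by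
      funext x; simp only [evenPart, glue, Fin.cons_zero, Fin.tail_cons]; simp; ring
    have go : ∀ p q, oddPart (glue p q) = fun x => s * q x := fun p q => by
      funext x; simp [oddPart, glue]
    refine ⟨glue l₀ l₁, glue h₀ h₁, ?_, ?_, ?_⟩
    · refine fun z => congrFun (ext_parts ?_ ?_ :
        noiseOp s u = fun x => glue l₀ l₁ x + glue h₀ h₁ x) z
      · rw [evenPart_noiseOp]
        funext x
        have := congrFun (ge l₀ l₁) x
        have := congrFun (ge h₀ h₁) x
        rw [e₀]
        simp only [evenPart] at *
        linarith
      · rw [oddPart_noiseOp]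
        funext x
        have := congrFun (go l₀ l₁) x
        have := congrFun (go h₀ h₁) x
        rw [e₁]
        simp only [oddPart] at *
        linarith
    · rw [mean_pow_four_parts, ge, go, mean_sq_parts]
      simp only [mul_pow, fun a b : ℝ => mul_left_comm (a ^ 2) (s ^ 2) b, mean_const_mul]
      set A := mean (fun x => evenPart u x ^ 2)
      set B := mean (fun x => oddPart u x ^ 2)
      have hA : 0 ≤ A := mean_nonneg fun x => sq_nonneg _
      have hB : 0 ≤ B := mean_nonneg fun x => sq_nonneg _
      set P := mean (fun x => l₀ x ^ 4)
      set Q := mean (fun x => l₁ x ^ 4)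
      have hP : 0 ≤ P := mean_nonneg fun x => by positivity
      have hQ : 0 ≤ Q := mean_nonneg fun x => by positivity
      set R := mean (fun x => l₀ x ^ 2 * l₁ x ^ 2)
      have hR : 0 ≤ R := mean_nonneg fun x => by positivity
      have hcs : R ^ 2 ≤ P * Q := by
        have := mean_sq_mul_le (fun x => l₀ x ^ 2) (fun x => l₁ x ^ 2)
        simpa only [← pow_mul] using this
      -- The base 9 is chosen so that 9^(k+1) · 9^k = (3 · 9^k)². Then 6R is at most 2 · 9^(k+1) ·
      -- AB, exactly the cross term of 9^(k+1) (A + B)².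
      have hR' : R ≤ 3 * 9 ^ k * (A * B) := by
        refine abs_le_of_sq_le_sq' ?_ (by positivity) |>.2
        calc R ^ 2 ≤ P * Q := hcs
          _ ≤ (9 ^ (k + 1) * A ^ 2) * (9 ^ k * B ^ 2) := by gcongr
          _ = _ := by ring
      have hs4 : s ^ 4 ≤ 1 := by nlinarith [sq_nonneg s]
      have i1 : s ^ 2 * R ≤ R := mul_le_of_le_one_left hR hs
      have i2 : s ^ 4 * Q ≤ Q := mul_le_of_le_one_left hQ hs4
      have h9 : (0 : ℝ) ≤ 9 ^ k * B ^ 2 := by positivity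
      calc P + 6 * (s ^ 2 * R) + s ^ 4 * Q
          ≤ 9 ^ (k + 1) * A ^ 2 + 6 * (3 * 9 ^ k * (A * B)) + 9 ^ k * B ^ 2 := by linarith
        _ ≤ 9 ^ (k + 1) * (A + B) ^ 2 := by
          rw [pow_succ]; linear_combination 8 * h9
    · rw [mean_sq_parts, ge, go, mean_sq_parts u]
      simp only [mul_pow, mean_const_mul]
      have := mul_le_mul_of_nonneg_left b₁ (sq_nonneg s)
      linear_combination b₀ + this

/-- With w = T_s u = l + h, bound |w|³ by |w| (2l² + 2h²). The low part is handled by AM-GM with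
weight `c`, the high part by |w| ≤ 1. The bound is linear in the second moment, so when `u` runs
over derivatives it can be summed against the total influence. -/
theorem mean_abs_noiseOp_cube_le {s ε c : ℝ} (hs : s ^ 2 ≤ 1) (hc : 0 < c) (k : ℕ)
    (hk : 9 ^ k * ε ≤ c ^ 2) {u : Cube n → ℝ} (hu : ∀ x, u x ∈ Set.Icc (-1 : ℝ) 1)
    (hε : mean (fun x => u x ^ 2) ≤ ε) :
    mean (fun x => |noiseOp s u x| ^ 3) ≤
      (2 * c + 2 * (s ^ 2) ^ k) * mean (fun x => u x ^ 2) := by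
  obtain ⟨l, h, e, hl, hh⟩ := exists_low_add_high hs k u
  have hw : ∀ x, |noiseOp s u x| ≤ 1 := fun x =>
    abs_le.2 (noiseOp_mem_Icc (by nlinarith) (by nlinarith) hu x)
  set m := mean (fun x => u x ^ 2)
  have hm : 0 ≤ m := mean_nonneg fun x => sq_nonneg _
  have hpt : ∀ x, |noiseOp s u x| ^ 3 ≤
      (c * noiseOp s u x ^ 2 + c⁻¹ * l x ^ 4) + 2 * h x ^ 2 := by
    intro x
    have h0 := abs_nonneg (noiseOp s u x)
    have h1 : |noiseOp s u x| ^ 2 ≤ 2 * l x ^ 2 + 2 * h x ^ 2 := by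
      rw [sq_abs, e]; nlinarith [sq_nonneg (l x - h x)]
    have h2 : 2 * (|noiseOp s u x| * l x ^ 2) ≤ c * |noiseOp s u x| ^ 2 + c⁻¹ * l x ^ 4 := by
      have h3 := mul_nonneg (inv_nonneg.2 hc.le) (sq_nonneg (c * |noiseOp s u x| - l x ^ 2))
      have h4 : c⁻¹ * c = 1 := inv_mul_cancel₀ hc.ne'
      have h5 : c⁻¹ * (c * |noiseOp s u x| - l x ^ 2) ^ 2 =
          (c⁻¹ * c) * (c * |noiseOp s u x| ^ 2) - 2 * (c⁻¹ * c) * (|noiseOp s u x| * l x ^ 2) +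
            c⁻¹ * l x ^ 4 := by ring
      rw [h5, h4] at h3
      linarith
    rw [← sq_abs (noiseOp s u x)]
    calc |noiseOp s u x| ^ 3 = |noiseOp s u x| * |noiseOp s u x| ^ 2 := by ring
      _ ≤ |noiseOp s u x| * (2 * l x ^ 2 + 2 * h x ^ 2) := by gcongr
      _ = 2 * (|noiseOp s u x| * l x ^ 2) + |noiseOp s u x| * (2 * h x ^ 2) := by ring
      _ ≤ _ := add_le_add h2 (mul_le_of_le_one_left (by positivity) (hw x))
  refine (mean_mono hpt).trans ?_
  rw [mean_add, mean_add, mean_const_mul, mean_const_mul, mean_const_mul]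
  have i1 := mul_le_mul_of_nonneg_left (mean_noiseOp_sq_le hs u) hc.le
  have i2 : c⁻¹ * mean (fun x => l x ^ 4) ≤ c * m := by
    rw [inv_mul_le_iff₀ hc]
    calc mean (fun x => l x ^ 4) ≤ 9 ^ k * m ^ 2 := hl
      _ = (9 ^ k * m) * m := by ring
      _ ≤ (9 ^ k * ε) * m := by gcongr
      _ ≤ c ^ 2 * m := by gcongr
      _ = c * (c * m) := by ring
  linarith

/-- For a bounded function with small influences, the third moments of the derivatives of its
smoothing add up to little. -/
theorem exists_sum_mean_abs_deriv_cube_le {s : ℝ} (hs0 : 0 < s) (hs1 : s < 1) {η : ℝ}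
    (hη : 0 < η) : ∃ ε > 0, ∀ (n : ℕ) (f : Cube n → ℝ), (∀ x, f x ∈ Set.Icc (-1 : ℝ) 1) →
      (∀ i, influence i f ≤ ε) →
      ∑ i, mean (fun x => |discreteDeriv i (noiseOp s (noiseOp s f)) x| ^ 3) ≤ η := by
  have hs2 : s ^ 2 < 1 := by nlinarith
  -- `C` bounds the total influence of `noiseOp s f`. Choosing `k` with s^(2k) < c makes the factor
  -- 2c + 2s^(2k) at most 4c, whence c = η / (4C). The threshold ε = c² / 9^k is the largest allowed
  -- by the fourth-moment condition.
  set C := s ^ 2 / (1 - s ^ 2)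
  have hC : 0 < C := div_pos (by positivity) (by linarith)
  set c := η / (4 * C)
  have hc : 0 < c := by positivity
  obtain ⟨k, hk⟩ := exists_pow_lt_of_lt_one hc hs2
  refine ⟨c ^ 2 / 9 ^ k, by positivity, fun n f hf hinf => ?_⟩
  have hf2 := noiseOp_mem_Icc (by linarith) hs1.le hf
  have key : ∀ i, mean (fun x => |discreteDeriv i (noiseOp s (noiseOp s f)) x| ^ 3) ≤
      (2 * c + 2 * (s ^ 2) ^ k) * influence i (noiseOp s f) := by
    intro i
    have hm : influence i (noiseOp s f) ≤ c ^ 2 / 9 ^ k := by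
      refine le_trans ?_ (hinf i)
      simp only [influence, discreteDeriv_noiseOp, mul_pow, mean_const_mul]
      exact (mul_le_of_le_one_left (mean_nonneg fun x => sq_nonneg _) hs2.le).trans
        (mean_noiseOp_sq_le hs2.le _)
    refine le_trans (mean_mono fun x => ?_) (mean_abs_noiseOp_cube_le (c := c) hs2.le hc k
      (by rw [mul_div_cancel₀ _ (by positivity)])
      (fun x => abs_le.1 (abs_discreteDeriv_le hf2 i x)) hm)
    rw [discreteDeriv_noiseOp, abs_mul, abs_of_pos hs0]
    gcongr
    exact mul_le_of_le_one_left (abs_nonneg _) hs1.le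
  have hI : ∑ i, influence i (noiseOp s f) ≤ C := by
    have h1 := sum_influence_noiseOp_add_le hs2.le f
    have h2 : mean (fun x => f x ^ 2) ≤ 1 := by
      rw [← mean_const (n := n) 1]
      exact mean_mono fun x => by nlinarith [(hf x).1, (hf x).2]
    have h3 : 0 ≤ mean (fun x => noiseOp s f x ^ 2) := mean_nonneg fun x => sq_nonneg _
    rw [le_div_iff₀ (by linarith)]
    nlinarith [sq_nonneg s]
  calc ∑ i, mean (fun x => |discreteDeriv i (noiseOp s (noiseOp s f)) x| ^ 3)
      ≤ ∑ i, (2 * c + 2 * (s ^ 2) ^ k) * influence i (noiseOp s f) :=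
        Finset.sum_le_sum fun i _ => key i
    _ = (2 * c + 2 * (s ^ 2) ^ k) * ∑ i, influence i (noiseOp s f) := by rw [Finset.mul_sum]
    _ ≤ (4 * c) * C := by
      gcongr
      · exact Finset.sum_nonneg fun i _ => mean_nonneg fun x => sq_nonneg _
      · linarith
    _ = η := by simp only [c]; field_simp

end

end BooleanCube

/-! ### Tensorization of two-point inequalities, and the reduction of negative to positive
correlation. -/

namespace BooleanCube

noncomputable section

variable {n : ℕ}

/-! ### Correlated pairs -/

/-- The expectation of `F x y` for `x` uniform and `y` a `ρ`-correlated copy of `x`. -/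
def pairMean (ρ : ℝ) (F : Cube n → Cube n → ℝ) : ℝ :=
  mean fun x => ∑ y, copyProb ρ x y * F x y

theorem pairMean_zero (ρ : ℝ) (F : Cube 0 → Cube 0 → ℝ) (x : Cube 0) : pairMean ρ F = F x x := by
  have h := congrFun (noiseOp_zero ρ (F x)) x
  rw [pairMean, mean_zero _ x]
  exact h

theorem pairMean_mono {ρ : ℝ} (h1 : -1 ≤ ρ) (h2 : ρ ≤ 1) {F G : Cube n → Cube n → ℝ}
    (h : ∀ x y, F x y ≤ G x y) : pairMean ρ F ≤ pairMean ρ G :=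
  mean_mono fun x => Finset.sum_le_sum fun y _ =>
    mul_le_mul_of_nonneg_left (h x y) (copyProb_nonneg h1 h2 x y)

theorem pairMean_mul (ρ : ℝ) (f g : Cube n → ℝ) :
    pairMean ρ (fun x y => f x * g y) = mean fun x => f x * noiseOp ρ g x := by
  simp only [pairMean, noiseOp, Finset.mul_sum, mul_left_comm]

theorem pairMean_succ (ρ : ℝ) (F : Cube (n + 1) → Cube (n + 1) → ℝ) :
    pairMean ρ F =
      (1 + ρ) / 4 * (pairMean ρ (fun x y => F (Fin.cons 1 x) (Fin.cons 1 y)) +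
        pairMean ρ (fun x y => F (Fin.cons (-1) x) (Fin.cons (-1) y))) +
      (1 - ρ) / 4 * (pairMean ρ (fun x y => F (Fin.cons 1 x) (Fin.cons (-1) y)) +
        pairMean ρ (fun x y => F (Fin.cons (-1) x) (Fin.cons 1 y))) := by
  simp only [pairMean]
  rw [mean_succ]
  simp only [sum_copyProb_cons_one, sum_copyProb_cons_neg_one, mean_add, mean_const_mul]
  ring

theorem mean_mem_Icc {a b : ℝ} {f : Cube n → ℝ} (hf : ∀ x, f x ∈ Set.Icc a b) :
    mean f ∈ Set.Icc a b :=
  ⟨(mean_const (n := n) a).symm.le.trans (mean_mono fun x => (hf x).1),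
    (mean_mono fun x => (hf x).2).trans (mean_const (n := n) b).le⟩

theorem sum_mean_deriv_succ (e : ℝ → ℝ) (f : Cube (n + 1) → ℝ) :
    ∑ i, mean (fun x => e (discreteDeriv i f x)) =
      mean (fun x => e (oddPart f x)) +
      ((∑ i, mean fun x => e (discreteDeriv i (fun y => f (Fin.cons 1 y)) x)) +
        ∑ i, mean fun x => e (discreteDeriv i (fun y => f (Fin.cons (-1) y)) x)) / 2 := by
  rw [Fin.sum_univ_succ, mean_succ]
  simp only [discreteDeriv_zero, add_self_div_two]
  rw [← Finset.sum_add_distrib, Finset.sum_div]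
  congr 1
  refine Finset.sum_congr rfl fun j _ => ?_
  rw [mean_succ]
  simp only [discreteDeriv_succ]

/-- A two-point inequality with an error term tensorizes. -/
theorem pairMean_le_of_two_point {ρ a b : ℝ} (h1 : -1 ≤ ρ) (h2 : ρ ≤ 1) {B : ℝ → ℝ → ℝ}
    {e : ℝ → ℝ} (he : ∀ p q, e ((p + q) / 2) ≤ (e p + e q) / 2)
    (hB : ∀ x y c d, x + c ∈ Set.Icc a b → x - c ∈ Set.Icc a b → y + d ∈ Set.Icc a b →
      y - d ∈ Set.Icc a b →
      (1 + ρ) / 4 * (B (x + c) (y + d) + B (x - c) (y - d)) +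
        (1 - ρ) / 4 * (B (x + c) (y - d) + B (x - c) (y + d)) ≤ B x y + (e c + e d)) :
    ∀ {n : ℕ} (f g : Cube n → ℝ), (∀ x, f x ∈ Set.Icc a b) → (∀ x, g x ∈ Set.Icc a b) →
      pairMean ρ (fun x y => B (f x) (g y)) ≤ B (mean f) (mean g) +
        (∑ i, mean (fun x => e (discreteDeriv i f x)) +
          ∑ i, mean (fun x => e (discreteDeriv i g x)))
  | 0, f, g, _, _ => by
    rw [pairMean_zero ρ _ default, mean_zero f default, mean_zero g default]
    simp
  | n + 1, f, g, hf, hg => by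
    rw [pairMean_succ, sum_mean_deriv_succ, sum_mean_deriv_succ]
    have ih := pairMean_le_of_two_point h1 h2 he hB (n := n)
    set f₁ : Cube n → ℝ := fun x => f (Fin.cons 1 x) with hf₁
    set f₂ : Cube n → ℝ := fun x => f (Fin.cons (-1) x) with hf₂
    set g₁ : Cube n → ℝ := fun x => g (Fin.cons 1 x) with hg₁
    set g₂ : Cube n → ℝ := fun x => g (Fin.cons (-1) x) with hg₂
    have mf₁ : ∀ x, f₁ x ∈ Set.Icc a b := fun x => hf _
    have mf₂ : ∀ x, f₂ x ∈ Set.Icc a b := fun x => hf _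
    have mg₁ : ∀ x, g₁ x ∈ Set.Icc a b := fun x => hg _
    have mg₂ : ∀ x, g₂ x ∈ Set.Icc a b := fun x => hg _
    -- All four pairs of restrictions occur, including mixed ones; hence the statement needs two
    -- functions even though it is applied to one.
    have i11 := ih f₁ g₁ mf₁ mg₁
    have i12 := ih f₁ g₂ mf₁ mg₂
    have i21 := ih f₂ g₁ mf₂ mg₁
    have i22 := ih f₂ g₂ mf₂ mg₂
    have of : mean (oddPart f) = (mean f₁ - mean f₂) / 2 := by
      have : oddPart f = fun x => 1 / 2 * (f₁ x - f₂ x) := by funext x; simp only [oddPart, f₁, f₂]; ring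
      rw [this, mean_const_mul, mean_sub]; ring
    have og : mean (oddPart g) = (mean g₁ - mean g₂) / 2 := by
      have : oddPart g = fun x => 1 / 2 * (g₁ x - g₂ x) := by funext x; simp only [oddPart, g₁, g₂]; ring
      rw [this, mean_const_mul, mean_sub]; ring
    have ef : mean f = (mean f₁ + mean f₂) / 2 := mean_succ f
    have eg : mean g = (mean g₁ + mean g₂) / 2 := mean_succ g
    have pf : mean f + mean (oddPart f) = mean f₁ := by rw [ef, of]; ring
    have qf : mean f - mean (oddPart f) = mean f₂ := by rw [ef, of]; ring
    have pg : mean g + mean (oddPart g) = mean g₁ := by rw [eg, og]; ring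
    have qg : mean g - mean (oddPart g) = mean g₂ := by rw [eg, og]; ring
    have two := hB (mean f) (mean g) (mean (oddPart f)) (mean (oddPart g))
      (by rw [pf]; exact mean_mem_Icc mf₁) (by rw [qf]; exact mean_mem_Icc mf₂)
      (by rw [pg]; exact mean_mem_Icc mg₁) (by rw [qg]; exact mean_mem_Icc mg₂)
    rw [pf, qf, pg, qg] at two
    -- The two-point inequality at the means costs `e` of the mean of the first derivative. By
    -- Jensen this is at most the first-coordinate term of the error sum.
    have jf := map_mean_le he (oddPart f)
    have jg := map_mean_le he (oddPart g)
    have w1 : 0 ≤ (1 + ρ) / 4 := by linarith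
    have w2 : 0 ≤ (1 - ρ) / 4 := by linarith
    linear_combination mul_le_mul_of_nonneg_left i11 w1 + mul_le_mul_of_nonneg_left i22 w1 +
      mul_le_mul_of_nonneg_left i12 w2 + mul_le_mul_of_nonneg_left i21 w2 + two + jf + jg

/-! ### Stability under reflection -/

/-- T_ρ is the square of the self-adjoint operator T_√ρ. -/
theorem stab_nonneg {ρ : ℝ} (hρ : 0 ≤ ρ) (f : Cube n → ℝ) : 0 ≤ stab ρ f := by
  have h : stab ρ f = mean fun x => noiseOp (√ρ) f x ^ 2 := by
    unfold stab
    rw [← Real.mul_self_sqrt hρ, ← noiseOp_noiseOp, mean_mul_noiseOp_comm, Real.mul_self_sqrt hρ]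
    simp only [sq]
  rw [h]
  exact mean_nonneg fun x => sq_nonneg _

theorem stab_le_one {ρ : ℝ} (h1 : -1 ≤ ρ) (h2 : ρ ≤ 1) {f : Cube n → ℝ}
    (hf : ∀ x, f x ∈ Set.Icc (-1 : ℝ) 1) : stab ρ f ≤ 1 := by
  rw [← mean_const (n := n) 1]
  refine mean_mono fun x => ?_
  have h3 := hf x
  have h4 := noiseOp_mem_Icc h1 h2 hf x
  nlinarith [h3.1, h3.2, h4.1, h4.2]

theorem copyProb_neg_right (ρ : ℝ) (x y : Cube n) : copyProb ρ x (-y) = copyProb (-ρ) x y := by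
  refine Finset.prod_congr rfl fun i _ => ?_
  rcases Int.units_eq_one_or (x i) with h | h <;> rcases Int.units_eq_one_or (y i) with h' | h' <;>
    simp [h, h', sub_eq_add_neg]

theorem noiseOp_neg (ρ : ℝ) (f : Cube n → ℝ) (x : Cube n) :
    noiseOp (-ρ) f x = noiseOp ρ (fun y => f (-y)) x := by
  simp only [noiseOp]
  rw [← Equiv.sum_comp (Equiv.neg (Cube n))]
  simp only [Equiv.neg_apply, copyProb_neg_right, neg_neg]

/-- The part of `f` that is odd under `x ↦ -x`. -/
def antisymm (f : Cube n → ℝ) (x : Cube n) : ℝ := (f x - f (-x)) / 2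

/-- Write f = e + o with e even and o odd under x ↦ -x. Then Stab_{-ρ}[f] = Stab_ρ[e] - Stab_ρ[o],
the cross terms cancelling by self-adjointness, and the even contribution is nonnegative. -/
theorem neg_stab_antisymm_le {ρ : ℝ} (hρ : 0 ≤ ρ) (f : Cube n → ℝ) :
    -stab ρ (antisymm f) ≤ stab (-ρ) f := by
  set o : Cube n → ℝ := antisymm f with ho
  set e : Cube n → ℝ := fun x => (f x + f (-x)) / 2 with he
  have hf : f = fun x => e x + o x := by
    funext x; simp only [he, ho, antisymm]; ring
  have hf' : (fun x => f (-x)) = fun x => e x - o x := by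
    funext x; simp only [he, ho, antisymm]; ring
  have h : stab (-ρ) f = stab ρ e - stab ρ o := by
    have h1 : stab (-ρ) f = mean fun x => (e x + o x) * (noiseOp ρ e x - noiseOp ρ o x) := by
      unfold stab
      congr 1
      funext x
      rw [noiseOp_neg, hf', noiseOp_sub, ← congrFun hf x]
    have h2 := mean_mul_noiseOp_comm ρ e o
    have h3 : (fun x => (e x + o x) * (noiseOp ρ e x - noiseOp ρ o x)) = fun x =>
        (e x * noiseOp ρ e x - o x * noiseOp ρ o x) +
          (noiseOp ρ e x * o x - e x * noiseOp ρ o x) := by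
      funext x; ring
    rw [h1, h3, mean_add, mean_sub, mean_sub, h2]
    simp only [stab, sub_self, add_zero]
  rw [h]
  linarith [stab_nonneg hρ e]

theorem mean_antisymm (f : Cube n → ℝ) : mean (antisymm f) = 0 := by
  have h : antisymm f = fun x => 1 / 2 * (f x - f (-x)) := by
    funext x; simp only [antisymm]; ring
  have h2 := mean_comp_equiv (Equiv.neg (Cube n)) f
  simp only [Equiv.neg_apply] at h2
  rw [h, mean_const_mul, mean_sub, h2]
  ring

theorem antisymm_mem_Icc {f : Cube n → ℝ} (hf : ∀ x, f x ∈ Set.Icc (-1 : ℝ) 1) (x : Cube n) :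
    antisymm f x ∈ Set.Icc (-1 : ℝ) 1 := by
  unfold antisymm
  constructor <;> linarith [(hf x).1, (hf x).2, (hf (-x)).1, (hf (-x)).2]

theorem discreteDeriv_antisymm (i : Fin n) (f : Cube n → ℝ) (x : Cube n) :
    discreteDeriv i (antisymm f) x = (discreteDeriv i f x + discreteDeriv i f (-x)) / 2 := by
  have h : ∀ u : ℤˣ, -Function.update x i u = Function.update (-x) i (-u) := by
    intro u
    funext j
    by_cases hj : j = i
    · subst hj; simp
    · simp [hj]
  simp only [discreteDeriv, antisymm, h, neg_neg]
  ring

theorem influence_antisymm_le (i : Fin n) (f : Cube n → ℝ) :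
    influence i (antisymm f) ≤ influence i f := by
  have h2 := mean_comp_equiv (Equiv.neg (Cube n)) fun x => discreteDeriv i f x ^ 2
  simp only [Equiv.neg_apply] at h2
  have h : influence i (antisymm f) ≤
      mean fun x => 1 / 2 * (discreteDeriv i f x ^ 2 + discreteDeriv i f (-x) ^ 2) := by
    refine mean_mono fun x => ?_
    rw [discreteDeriv_antisymm]
    nlinarith [sq_nonneg (discreteDeriv i f x - discreteDeriv i f (-x))]
  rw [mean_const_mul, mean_add, h2] at h
  simp only [influence] at h ⊢
  linarith

end

end BooleanCube

/-! ### Calculus of the one- and two-dimensional normal distribution. -/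

namespace GaussianStability

open MeasureTheory Set Real

noncomputable section

/-! ### The standard normal distribution -/

/-- The density of the standard normal distribution. -/
def pdf (u : ℝ) : ℝ := (√(2 * π))⁻¹ * exp (-u ^ 2 / 2)

theorem pdf_eq_gaussianPDFReal : pdf = ProbabilityTheory.gaussianPDFReal 0 1 := by
  funext u
  simp [pdf, ProbabilityTheory.gaussianPDFReal]

theorem pdf_pos (u : ℝ) : 0 < pdf u := by unfold pdf; positivity

theorem contDiff_pdf {k : WithTop ℕ∞} : ContDiff ℝ k pdf := by unfold pdf; fun_prop

theorem continuous_pdf : Continuous pdf := contDiff_pdf (k := 0) |>.continuous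

theorem pdf_neg (u : ℝ) : pdf (-u) = pdf u := by simp [pdf]

theorem pdf_le_one (u : ℝ) : pdf u ≤ 1 := by
  unfold pdf
  have h1 : 1 ≤ √(2 * π) := by
    rw [Real.one_le_sqrt]; linarith [Real.pi_gt_three]
  have h2 : exp (-u ^ 2 / 2) ≤ 1 := by rw [exp_le_one_iff]; nlinarith [sq_nonneg u]
  exact mul_le_one₀ (inv_le_one_of_one_le₀ h1) (exp_pos _).le h2

theorem integrable_pdf : Integrable pdf := by
  rw [pdf_eq_gaussianPDFReal]; exact ProbabilityTheory.integrable_gaussianPDFReal 0 1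

theorem integral_pdf : ∫ u, pdf u = 1 := by
  rw [pdf_eq_gaussianPDFReal]
  exact ProbabilityTheory.integral_gaussianPDFReal_eq_one 0 one_ne_zero

theorem integrable_pdf_mul_id : Integrable fun u => pdf u * u := by
  have h := (integrable_mul_exp_neg_mul_sq (b := 1 / 2) (by norm_num)).const_mul (√(2 * π))⁻¹
  refine h.congr (ae_of_all _ fun u => ?_)
  simp only [pdf]
  ring_nf

theorem hasDerivAt_integral_Iic {g : ℝ → ℝ} (hg : Integrable g) (hc : Continuous g) (t : ℝ) :
    HasDerivAt (fun t => ∫ u in Iic t, g u) (g t) t := by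
  have h : (fun t => ∫ u in Iic t, g u) = fun t => (∫ u in Iic 0, g u) + ∫ u in (0 : ℝ)..t, g u := by
    funext t
    rw [← intervalIntegral.integral_Iic_sub_Iic hg.integrableOn hg.integrableOn]
    ring
  rw [h]
  exact (intervalIntegral.integral_hasDerivAt_right (hc.intervalIntegrable _ _)
    (hc.stronglyMeasurableAtFilter _ _) hc.continuousAt).const_add _

/-- The distribution function of the standard normal distribution. -/
def cdf (t : ℝ) : ℝ := ∫ u in Iic t, pdf u

theorem hasDerivAt_cdf (t : ℝ) : HasDerivAt cdf (pdf t) t :=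
  hasDerivAt_integral_Iic integrable_pdf continuous_pdf t

theorem continuous_cdf : Continuous cdf :=
  continuous_iff_continuousAt.2 fun t => (hasDerivAt_cdf t).continuousAt

theorem strictMono_cdf : StrictMono cdf :=
  strictMono_of_deriv_pos fun t => by rw [(hasDerivAt_cdf t).deriv]; exact pdf_pos t

theorem cdf_neg (t : ℝ) : cdf (-t) = 1 - cdf t := by
  have h1 : cdf (-t) = ∫ u in Ioi t, pdf u := by
    rw [cdf, ← integral_comp_neg_Ioi]
    simp only [pdf_neg]
  have h2 := integral_add_compl (measurableSet_Iic (a := t)) integrable_pdf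
  rw [compl_Iic, integral_pdf] at h2
  rw [h1, cdf]
  linarith

theorem cdf_zero : cdf 0 = 1 / 2 := by
  have := cdf_neg 0
  rw [neg_zero] at this
  linarith

theorem tendsto_cdf_atTop : Tendsto cdf atTop (𝓝 1) := by
  rw [← integral_pdf]
  exact (aecover_Iic tendsto_id).integral_tendsto_of_countably_generated integrable_pdf

theorem tendsto_cdf_atBot : Tendsto cdf atBot (𝓝 0) := by
  have h : cdf = fun t => 1 - cdf (-t) := by funext t; rw [cdf_neg]; ring
  rw [h]
  simpa using (tendsto_cdf_atTop.comp tendsto_neg_atBot_atTop).const_sub 1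

theorem cdf_lt_one (t : ℝ) : cdf t < 1 :=
  (strictMono_cdf (lt_add_one t)).trans_le
    (strictMono_cdf.monotone.ge_of_tendsto tendsto_cdf_atTop _)

theorem cdf_pos (t : ℝ) : 0 < cdf t := by
  have := cdf_lt_one (-t)
  rw [cdf_neg] at this
  linarith

theorem abs_cdf_le_one (t : ℝ) : |cdf t| ≤ 1 := by
  rw [abs_of_pos (cdf_pos t)]; exact (cdf_lt_one t).le

theorem exists_cdf_eq {x : ℝ} (hx : x ∈ Ioo (0 : ℝ) 1) : ∃ t, cdf t = x := by
  apply mem_range_of_exists_le_of_exists_ge continuous_cdf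
  · exact (tendsto_cdf_atBot.eventually (gt_mem_nhds hx.1)).exists.imp fun t h => h.le
  · exact (tendsto_cdf_atTop.eventually (lt_mem_nhds hx.2)).exists.imp fun t h => h.le

/-- The quantile function of the standard normal distribution. -/
def quantile : ℝ → ℝ := Function.invFun cdf

theorem cdf_quantile {x : ℝ} (hx : x ∈ Ioo (0 : ℝ) 1) : cdf (quantile x) = x :=
  Function.invFun_eq (exists_cdf_eq hx)

theorem quantile_cdf (t : ℝ) : quantile (cdf t) = t :=
  Function.leftInverse_invFun strictMono_cdf.injective t

theorem quantile_half : quantile (1 / 2) = 0 := by rw [← cdf_zero, quantile_cdf]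

theorem hasDerivAt_quantile {x : ℝ} (hx : x ∈ Ioo (0 : ℝ) 1) :
    HasDerivAt quantile (pdf (quantile x))⁻¹ x := by
  have h0 : HasStrictDerivAt cdf (pdf (quantile x)) (quantile x) :=
    hasStrictDerivAt_of_hasDerivAt_of_continuousAt (.of_forall hasDerivAt_cdf)
      continuous_pdf.continuousAt
  have h := h0.to_local_left_inverse (pdf_pos _).ne' (g := quantile) (.of_forall quantile_cdf)
  rw [cdf_quantile hx] at h
  exact h.hasDerivAt

theorem continuousOn_quantile : ContinuousOn quantile (Ioo 0 1) := fun _ hx =>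
  (hasDerivAt_quantile hx).continuousAt.continuousWithinAt

theorem contDiffOn_quantile : ContDiffOn ℝ 1 quantile (Ioo 0 1) := by
  rw [show (1 : WithTop ℕ∞) = 0 + 1 by simp, contDiffOn_succ_iff_deriv_of_isOpen isOpen_Ioo]
  refine ⟨fun x hx => (hasDerivAt_quantile hx).differentiableAt.differentiableWithinAt,
    by simp, contDiffOn_zero.2 ?_⟩
  refine ContinuousOn.congr (f := fun x => (pdf (quantile x))⁻¹) ?_
    fun x hx => (hasDerivAt_quantile hx).deriv
  exact (continuous_pdf.comp_continuousOn continuousOn_quantile).inv₀ fun x _ => (pdf_pos _).ne'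

/-! ### Bivariate normal probabilities -/

/-- Differentiation under the integral sign, dominated by |pdf u · r u| since `pdf ≤ 1`. The form p
+ t r covers both uses: moving the threshold (`r` constant) and moving the slope (r = -u). -/
theorem hasDerivAt_integral_pdf_mul_cdf (A : Set ℝ) {p r : ℝ → ℝ} (hp : Continuous p)
    (hr : Continuous r) (hi : Integrable fun u => pdf u * r u) (t₀ : ℝ) :
    HasDerivAt (fun t => ∫ u in A, pdf u * cdf (p u + t * r u))
      (∫ u in A, pdf u * (pdf (p u + t₀ * r u) * r u)) t₀ := by
  have hc : ∀ t, Continuous fun u => pdf u * cdf (p u + t * r u) := fun t =>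
    continuous_pdf.mul (continuous_cdf.comp (by fun_prop))
  have hc' : ∀ t, Continuous fun u => pdf u * (pdf (p u + t * r u) * r u) := fun t =>
    continuous_pdf.mul ((continuous_pdf.comp (by fun_prop)).mul hr)
  refine (hasDerivAt_integral_of_dominated_loc_of_deriv_le (s := univ)
    (F' := fun t u => pdf u * (pdf (p u + t * r u) * r u))
    (bound := fun u => ‖pdf u * r u‖) univ_mem
    (.of_forall fun t => (hc t).aestronglyMeasurable) ?_ (hc' t₀).aestronglyMeasurable
    (ae_of_all _ fun u t _ => ?_) hi.norm.integrableOn (ae_of_all _ fun u t _ => ?_)).2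
  · refine (Integrable.mono' integrable_pdf (hc t₀).aestronglyMeasurable
      (ae_of_all _ fun u => ?_)).integrableOn
    rw [norm_mul, Real.norm_eq_abs, Real.norm_eq_abs, abs_of_pos (pdf_pos u)]
    exact mul_le_of_le_one_right (pdf_pos u).le (abs_cdf_le_one _)
  · rw [norm_mul, norm_mul, norm_mul]
    gcongr
    refine mul_le_of_le_one_left (norm_nonneg _) ?_
    rw [Real.norm_eq_abs, abs_of_pos (pdf_pos _)]
    exact pdf_le_one _
  · have h1 : HasDerivAt (fun t => p u + t * r u) (r u) t := by
      simpa using ((hasDerivAt_id t).mul_const (r u)).const_add (p u)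
    exact ((hasDerivAt_cdf _).comp t h1).const_mul (pdf u)

variable {ρ : ℝ}

/-- The normalizing factor of the conditional distribution in a `ρ`-correlated normal pair. -/
def sd (ρ : ℝ) : ℝ := √(1 - ρ ^ 2)

theorem sd_pos (h0 : 0 ≤ ρ) (h1 : ρ < 1) : 0 < sd ρ := Real.sqrt_pos.2 (by nlinarith)

theorem sd_sq (h0 : 0 ≤ ρ) (h1 : ρ < 1) : sd ρ ^ 2 = 1 - ρ ^ 2 := Real.sq_sqrt (by nlinarith)

/-- Up to the factor `sd ρ`, both sides are the joint density, conditioned in the two possible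
orders. This symmetry replaces every exchange of integrals below. -/
theorem pdf_mul_pdf (h0 : 0 ≤ ρ) (h1 : ρ < 1) (s t : ℝ) :
    pdf s * pdf ((t - ρ * s) / sd ρ) = pdf t * pdf ((s - ρ * t) / sd ρ) := by
  have hσ := sd_pos h0 h1
  have key : -s ^ 2 / 2 + -((t - ρ * s) / sd ρ) ^ 2 / 2 =
      -t ^ 2 / 2 + -((s - ρ * t) / sd ρ) ^ 2 / 2 := by
    rw [div_pow, div_pow]
    have h2 : sd ρ ^ 2 ≠ 0 := by positivity
    field_simp
    rw [sd_sq h0 h1]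
    ring
  simp only [pdf]
  rw [mul_mul_mul_comm, ← exp_add, key, exp_add]
  ring

theorem hasDerivAt_cdf_comp_div (c σ u : ℝ) :
    HasDerivAt (fun u => cdf ((u - c) / σ)) (pdf ((u - c) / σ) / σ) u := by
  have h1 : HasDerivAt (fun u => (u - c) / σ) (1 / σ) u :=
    ((hasDerivAt_id u).sub_const c).div_const σ
  have h := (hasDerivAt_cdf _).comp u h1
  rwa [mul_one_div] at h

theorem integrable_pdf_comp_div (c : ℝ) {σ : ℝ} (hσ : 0 < σ) :
    Integrable fun u => pdf ((u - c) / σ) / σ :=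
  ((integrable_pdf.comp_div hσ.ne').comp_sub_right c).div_const σ

theorem tendsto_cdf_comp_div_atBot (c : ℝ) {σ : ℝ} (hσ : 0 < σ) :
    Tendsto (fun u => cdf ((u - c) / σ)) atBot (𝓝 0) :=
  tendsto_cdf_atBot.comp ((tendsto_atBot_add_const_right _ (-c) tendsto_id).atBot_div_const hσ)

theorem tendsto_cdf_comp_div_atTop (c : ℝ) {σ : ℝ} (hσ : 0 < σ) :
    Tendsto (fun u => cdf ((u - c) / σ)) atTop (𝓝 1) :=
  tendsto_cdf_atTop.comp ((tendsto_atTop_add_const_right _ (-c) tendsto_id).atTop_div_const hσ)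

theorem integral_Iic_pdf_comp_div (c s : ℝ) {σ : ℝ} (hσ : 0 < σ) :
    ∫ u in Iic s, pdf ((u - c) / σ) / σ = cdf ((s - c) / σ) := by
  have := integral_Iic_of_hasDerivAt_of_tendsto'
    (fun u _ => hasDerivAt_cdf_comp_div c σ u)
    (integrable_pdf_comp_div c hσ).integrableOn (tendsto_cdf_comp_div_atBot c hσ) (a := s)
  rw [this, sub_zero]

theorem integral_pdf_comp_div (c : ℝ) {σ : ℝ} (hσ : 0 < σ) :
    ∫ u, pdf ((u - c) / σ) / σ = 1 := by
  have := integral_of_hasDerivAt_of_tendsto (fun u => hasDerivAt_cdf_comp_div c σ u)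
    (integrable_pdf_comp_div c hσ) (tendsto_cdf_comp_div_atBot c hσ)
    (tendsto_cdf_comp_div_atTop c hσ)
  rw [this, sub_zero]

theorem continuous_pdf_mul_cdf (ρ t : ℝ) :
    Continuous fun u => pdf u * cdf ((t - ρ * u) / sd ρ) :=
  continuous_pdf.mul (continuous_cdf.comp (by fun_prop))

theorem integrable_pdf_mul_cdf (ρ t : ℝ) :
    Integrable fun u => pdf u * cdf ((t - ρ * u) / sd ρ) := by
  refine Integrable.mono' integrable_pdf (continuous_pdf_mul_cdf ρ t).aestronglyMeasurable
    (ae_of_all _ fun u => ?_)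
  rw [norm_mul, Real.norm_eq_abs, Real.norm_eq_abs, abs_of_pos (pdf_pos u)]
  exact mul_le_of_le_one_right (pdf_pos u).le (abs_cdf_le_one _)

/-- The probability that the first coordinate of a `ρ`-correlated standard normal pair lies in `A`
and the second is at most `t`. -/
def pairProb (ρ : ℝ) (A : Set ℝ) (t : ℝ) : ℝ := ∫ u in A, pdf u * cdf ((t - ρ * u) / sd ρ)

theorem hasDerivAt_pairProb (h0 : 0 ≤ ρ) (h1 : ρ < 1) (A : Set ℝ) (t : ℝ) :
    HasDerivAt (pairProb ρ A) (pdf t * ∫ u in A, pdf ((u - ρ * t) / sd ρ) / sd ρ) t := by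
  have h := hasDerivAt_integral_pdf_mul_cdf A (p := fun u => -(ρ * u) / sd ρ)
    (r := fun _ => 1 / sd ρ) (by fun_prop) continuous_const (integrable_pdf.mul_const _) t
  have e : ∀ t u, -(ρ * u) / sd ρ + t * (1 / sd ρ) = (t - ρ * u) / sd ρ := fun t u => by ring
  simp only [e] at h
  have hv : ∀ u, pdf u * (pdf ((t - ρ * u) / sd ρ) * (1 / sd ρ)) =
      pdf t * (pdf ((u - ρ * t) / sd ρ) / sd ρ) := fun u => by
    rw [← mul_assoc, pdf_mul_pdf h0 h1]
    ring
  simp only [hv, integral_const_mul] at h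
  exact h

/-- The second marginal is standard normal: both sides have the same derivative in `t`, and at 0
both equal 1/2 by the reflection u ↦ -u. -/
theorem pairProb_univ (h0 : 0 ≤ ρ) (h1 : ρ < 1) (t : ℝ) : pairProb ρ univ t = cdf t := by
  have hd : ∀ t, HasDerivAt (fun t => pairProb ρ univ t - cdf t) 0 t := by
    intro t
    have h := (hasDerivAt_pairProb h0 h1 univ t).sub (hasDerivAt_cdf t)
    rwa [setIntegral_univ, integral_pdf_comp_div _ (sd_pos h0 h1), mul_one, sub_self] at h
  have hz : pairProb ρ univ 0 = 1 / 2 := by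
    have e1 : pairProb ρ univ 0 = ∫ u, pdf u * cdf (-(ρ * u / sd ρ)) := by
      simp only [pairProb, setIntegral_univ, zero_sub, neg_div]
    have e2 : ∫ u, pdf u * cdf (-(ρ * u / sd ρ)) = ∫ u, (pdf u - pdf u * cdf (-(ρ * u / sd ρ))) := by
      rw [← integral_neg_eq_self]
      refine integral_congr_ae (ae_of_all _ fun u => ?_)
      simp only [pdf_neg, mul_neg, neg_div, neg_neg, cdf_neg]
      ring
    rw [integral_sub integrable_pdf, integral_pdf] at e2
    · linarith
    · have := integrable_pdf_mul_cdf ρ 0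
      simpa only [zero_sub, neg_div] using this
  have := is_const_of_deriv_eq_zero (fun t => (hd t).differentiableAt) (fun t => (hd t).deriv) t 0
  simp only [hz, cdf_zero] at this
  linarith

theorem cdf_mul_cdf_le_pairProb (h0 : 0 ≤ ρ) (h1 : ρ < 1) (s t : ℝ) :
    cdf s * cdf t ≤ pairProb ρ (Iic s) t := by
  have hσ := sd_pos h0 h1
  have hanti : ∀ u v, u ≤ v → cdf ((t - ρ * v) / sd ρ) ≤ cdf ((t - ρ * u) / sd ρ) :=
    fun u v huv => strictMono_cdf.monotone (by gcongr)
  set g : ℝ → ℝ := fun u => pdf u * cdf ((t - ρ * u) / sd ρ)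
  have hg : Integrable g := integrable_pdf_mul_cdf ρ t
  have hsplit := integral_add_compl (measurableSet_Iic (a := s)) hg
  have hfull : ∫ u, g u = cdf t := by rw [← pairProb_univ h0 h1 t, pairProb, setIntegral_univ]
  rw [hfull, compl_Iic] at hsplit
  have hlow : cdf s * cdf t = ∫ u in Iic s, pdf u * cdf t := by rw [integral_mul_const, cdf]
  -- The conditional probability decreases in `u` and its total average is `cdf t`. Either it is at
  -- least `cdf t` on all of (-∞, s], or at most `cdf t` on all of (s, ∞), and the complement gives
  -- the bound.
  rcases le_total (cdf t) (cdf ((t - ρ * s) / sd ρ)) with h | h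
  · rw [hlow]
    refine setIntegral_mono_on (integrable_pdf.mul_const _).integrableOn hg.integrableOn
      measurableSet_Iic fun u hu => ?_
    exact mul_le_mul_of_nonneg_left (h.trans (hanti u s hu)) (pdf_pos u).le
  · have hhigh : ∫ u in Ioi s, g u ≤ ∫ u in Ioi s, pdf u * cdf t := by
      refine setIntegral_mono_on hg.integrableOn (integrable_pdf.mul_const _).integrableOn
        measurableSet_Ioi fun u hu => ?_
      exact mul_le_mul_of_nonneg_left ((hanti s u (mem_Ioi.1 hu).le).trans h) (pdf_pos u).le
    have hc := integral_add_compl (measurableSet_Iic (a := s)) integrable_pdf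
    rw [compl_Iic, integral_pdf] at hc
    rw [integral_mul_const] at hhigh
    have hc' : ∫ u in Ioi s, pdf u = 1 - cdf s := by rw [cdf]; linarith
    rw [hc'] at hhigh
    have : pairProb ρ (Iic s) t = ∫ u in Iic s, g u := rfl
    rw [this]
    linarith

theorem integral_Iic_neg_mul_exp {b : ℝ} (hb : 0 < b) :
    ∫ u in Iic (0 : ℝ), -u * exp (-b * u ^ 2 / 2) = 1 / b := by
  have hd : ∀ u : ℝ, HasDerivAt (fun u => exp (-b * u ^ 2 / 2) / b) (-u * exp (-b * u ^ 2 / 2)) u := by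
    intro u
    have h1 : HasDerivAt (fun u : ℝ => -b * u ^ 2 / 2) (-b * (2 * u) / 2) u := by
      simpa using (((hasDerivAt_pow 2 u).const_mul (-b)).div_const 2)
    have h2 := h1.exp.div_const b
    have h3 : exp (-b * u ^ 2 / 2) * (-b * (2 * u) / 2) / b = -u * exp (-b * u ^ 2 / 2) := by
      rw [div_eq_iff hb.ne']; ring
    rwa [h3] at h2
  have h_integrable : Integrable fun u : ℝ => -u * exp (-b * u ^ 2 / 2) := by
    have := (integrable_mul_exp_neg_mul_sq (b := b / 2) (by positivity)).neg
    refine this.congr (ae_of_all _ fun u => ?_)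
    simp only [Pi.neg_apply]
    ring_nf
  have ht : Tendsto (fun u : ℝ => exp (-b * u ^ 2 / 2) / b) atBot (𝓝 0) := by
    have h2 : Tendsto (fun u : ℝ => u ^ 2) atBot atTop := by
      simpa only [Function.comp_def, neg_sq] using
        (tendsto_pow_atTop (α := ℝ) two_ne_zero).comp tendsto_neg_atBot_atTop
    have h3 : Tendsto (fun u : ℝ => -b * u ^ 2 / 2) atBot atBot := by
      have := h2.const_mul_atTop_of_neg (r := -(b / 2)) (by linarith)
      refine this.congr fun u => by ring
    simpa using (tendsto_exp_atBot.comp h3).div_const b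
  have := integral_Iic_of_hasDerivAt_of_tendsto' (fun u _ => hd u) h_integrable.integrableOn ht (a := 0)
  rw [this]
  simp

/-- Sheppard's formula. As a function of the slope τ = ρ / sd ρ the probability has derivative 1 /
(2π (1 + τ²)), so it is 1/4 + arctan τ / (2π), and arctan τ = arcsin ρ. -/
theorem pairProb_zero (h0 : 0 ≤ ρ) (h1 : ρ < 1) :
    pairProb ρ (Iic 0) 0 = 1 / 4 + arcsin ρ / (2 * π) := by
  set F : ℝ → ℝ := fun τ => ∫ u in Iic (0 : ℝ), pdf u * cdf (0 + τ * -u)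
  have hd : ∀ τ, HasDerivAt (fun τ => F τ - arctan τ / (2 * π)) 0 τ := by
    intro τ
    have h := hasDerivAt_integral_pdf_mul_cdf (Iic 0) (p := fun _ => 0) (r := fun u => -u)
      continuous_const continuous_neg (by simpa using integrable_pdf_mul_id.neg) τ
    have hv : ∫ u in Iic (0 : ℝ), pdf u * (pdf (0 + τ * -u) * -u) = 1 / (1 + τ ^ 2) / (2 * π) := by
      rw [← integral_Iic_neg_mul_exp (b := 1 + τ ^ 2) (by positivity), ← integral_div]
      refine integral_congr_ae (ae_of_all _ fun u => ?_)
      have h2 : (√(2 * π))⁻¹ * (√(2 * π))⁻¹ = 1 / (2 * π) := by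
        rw [← mul_inv, Real.mul_self_sqrt (by positivity), one_div]
      have h3 : exp (-u ^ 2 / 2) * exp (-(τ * -u) ^ 2 / 2) = exp (-(1 + τ ^ 2) * u ^ 2 / 2) := by
        rw [← exp_add]; congr 1; ring
      simp only [pdf, zero_add]
      rw [← h3]
      linear_combination (exp (-u ^ 2 / 2) * exp (-(τ * -u) ^ 2 / 2) * -u) * h2
    rw [hv] at h
    have := h.sub ((hasDerivAt_arctan τ).div_const (2 * π))
    rwa [sub_self] at this
  have hF0 : F 0 = 1 / 4 := by
    simp only [F, zero_mul, add_zero, cdf_zero]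
    rw [integral_mul_const]
    have := cdf_zero
    rw [cdf] at this
    rw [this]
    norm_num
  have hc := is_const_of_deriv_eq_zero (fun t => (hd t).differentiableAt)
    (fun t => (hd t).deriv) (ρ / sd ρ) 0
  have hp : pairProb ρ (Iic 0) 0 = F (ρ / sd ρ) := by
    simp only [pairProb, F]
    refine integral_congr_ae (ae_of_all _ fun u => ?_)
    simp only
    congr 2
    ring
  simp only [hF0, arctan_zero, zero_div, sub_zero] at hc
  rw [hp, arcsin_eq_arctan ⟨by linarith, h1⟩]
  change F (ρ / sd ρ) = 1 / 4 + arctan (ρ / sd ρ) / (2 * π)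
  linarith

theorem hasDerivAt_pairProb_comp (h0 : 0 ≤ ρ) (h1 : ρ < 1) {S T : ℝ → ℝ} {a b r : ℝ}
    (hS : HasDerivAt S a r) (hT : HasDerivAt T b r) :
    HasDerivAt (fun r => pairProb ρ (Iic (S r)) (T r))
      (a * (pdf (S r) * cdf ((T r - ρ * S r) / sd ρ)) +
        b * (pdf (T r) * cdf ((S r - ρ * T r) / sd ρ))) r := by
  set K : ℝ → ℝ → ℝ := fun s t => pairProb ρ (Iic s) t
  have d1 : ∀ v : ℝ × ℝ, HasDerivAt (K · v.2) (pdf v.1 * cdf ((v.2 - ρ * v.1) / sd ρ)) v.1 :=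
    fun v => hasDerivAt_integral_Iic (integrable_pdf_mul_cdf ρ v.2)
      (continuous_pdf_mul_cdf ρ v.2) v.1
  have d2 : ∀ v : ℝ × ℝ, HasDerivAt (K v.1 ·) (pdf v.2 * cdf ((v.1 - ρ * v.2) / sd ρ)) v.2 := by
    intro v
    have := hasDerivAt_pairProb h0 h1 (Iic v.1) v.2
    rwa [integral_Iic_pdf_comp_div _ _ (sd_pos h0 h1)] at this
  have c1 : Continuous fun v : ℝ × ℝ => ContinuousLinearMap.toSpanSingleton ℝ
      (pdf v.1 * cdf ((v.2 - ρ * v.1) / sd ρ)) := by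
    refine (ContinuousLinearMap.toSpanSingletonCLE (𝕜 := ℝ) (E := ℝ)).continuous.comp ?_
    exact (continuous_pdf.comp continuous_fst).mul (continuous_cdf.comp (by fun_prop))
  have c2 : Continuous fun v : ℝ × ℝ => ContinuousLinearMap.toSpanSingleton ℝ
      (pdf v.2 * cdf ((v.1 - ρ * v.2) / sd ρ)) := by
    refine (ContinuousLinearMap.toSpanSingletonCLE (𝕜 := ℝ) (E := ℝ)).continuous.comp ?_
    exact (continuous_pdf.comp continuous_snd).mul (continuous_cdf.comp (by fun_prop))
  have hK := (hasStrictFDerivAt_uncurry_coprod (𝕜 := ℝ) (u := (S r, T r)) (f := K)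
    (f₁ := fun s t => ContinuousLinearMap.toSpanSingleton ℝ (pdf s * cdf ((t - ρ * s) / sd ρ)))
    (f₂ := fun s t => ContinuousLinearMap.toSpanSingleton ℝ (pdf t * cdf ((s - ρ * t) / sd ρ)))
    (.of_forall fun v => (d1 v).hasFDerivAt) (.of_forall fun v => (d2 v).hasFDerivAt)
    c1.continuousAt c2.continuousAt).hasFDerivAt
  have := hK.comp_hasDerivAt r (hS.prodMk hT)
  simpa [Function.HasUncurry.uncurry, Function.comp_def] using this

end

end GaussianStability

/-! ### The two-point inequality for the Gaussian stability function. -/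

namespace GaussianStability

open MeasureTheory Set Real

noncomputable section

variable {ρ : ℝ}

/-! ### The Gaussian stability function -/

/-- The probability that a `ρ`-correlated standard normal pair lies in the product of the two
lower half-lines of measures `x` and `y`. -/
def stabFun (ρ x y : ℝ) : ℝ := pairProb ρ (Iic (quantile x)) (quantile y)

theorem stabFun_half (h0 : 0 ≤ ρ) (h1 : ρ < 1) :
    stabFun ρ (1 / 2) (1 / 2) = 1 / 4 + arcsin ρ / (2 * π) := by
  rw [stabFun, quantile_half, pairProb_zero h0 h1]

theorem mul_le_stabFun (h0 : 0 ≤ ρ) (h1 : ρ < 1) {x y : ℝ} (hx : x ∈ Ioo (0 : ℝ) 1)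
    (hy : y ∈ Ioo (0 : ℝ) 1) : x * y ≤ stabFun ρ x y := by
  have := cdf_mul_cdf_le_pairProb h0 h1 (quantile x) (quantile y)
  rwa [cdf_quantile hx, cdf_quantile hy] at this

/-- The derivative of `stabFun` along a line with direction `(a, b)`. -/
def lineDeriv₁ (ρ a b x y : ℝ) : ℝ :=
  a * cdf ((quantile y - ρ * quantile x) / sd ρ) + b * cdf ((quantile x - ρ * quantile y) / sd ρ)

/-- The joint density of a `ρ`-correlated standard normal pair, at a pair of quantiles. -/
def density (ρ : ℝ) (p : ℝ × ℝ) : ℝ :=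
  pdf (quantile p.1) * pdf ((quantile p.2 - ρ * quantile p.1) / sd ρ) / sd ρ

/-- The second derivative of `stabFun` along a line with direction `(a, b)`. -/
def lineDeriv₂ (ρ a b x y : ℝ) : ℝ :=
  2 * (a * b) * (density ρ (x, y) * (pdf (quantile x))⁻¹ * (pdf (quantile y))⁻¹) -
    ρ * a ^ 2 * (density ρ (x, y) * (pdf (quantile x))⁻¹ * (pdf (quantile x))⁻¹) -
    ρ * b ^ 2 * (density ρ (x, y) * (pdf (quantile y))⁻¹ * (pdf (quantile y))⁻¹)

theorem hasDerivAt_stabFun_line (h0 : 0 ≤ ρ) (h1 : ρ < 1) {x y a b r : ℝ}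
    (hx : x + r * a ∈ Ioo (0 : ℝ) 1) (hy : y + r * b ∈ Ioo (0 : ℝ) 1) :
    HasDerivAt (fun r => stabFun ρ (x + r * a) (y + r * b))
      (lineDeriv₁ ρ a b (x + r * a) (y + r * b)) r := by
  have lx : HasDerivAt (fun r => x + r * a) a r := by
    simpa using ((hasDerivAt_id r).mul_const a).const_add x
  have ly : HasDerivAt (fun r => y + r * b) b r := by
    simpa using ((hasDerivAt_id r).mul_const b).const_add y
  have h := hasDerivAt_pairProb_comp h0 h1 ((hasDerivAt_quantile hx).comp r lx)
    ((hasDerivAt_quantile hy).comp r ly)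
  refine h.congr_deriv ?_
  have p1 := (pdf_pos (quantile (x + r * a))).ne'
  have p2 := (pdf_pos (quantile (y + r * b))).ne'
  simp only [lineDeriv₁, Function.comp]
  field_simp

theorem hasDerivAt_lineDeriv₁ (h0 : 0 ≤ ρ) (h1 : ρ < 1) {x y a b r : ℝ}
    (hx : x + r * a ∈ Ioo (0 : ℝ) 1) (hy : y + r * b ∈ Ioo (0 : ℝ) 1) :
    HasDerivAt (fun r => lineDeriv₁ ρ a b (x + r * a) (y + r * b))
      (lineDeriv₂ ρ a b (x + r * a) (y + r * b)) r := by
  have lx : HasDerivAt (fun r => x + r * a) a r := by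
    simpa using ((hasDerivAt_id r).mul_const a).const_add x
  have ly : HasDerivAt (fun r => y + r * b) b r := by
    simpa using ((hasDerivAt_id r).mul_const b).const_add y
  have qx := (hasDerivAt_quantile hx).comp r lx
  have qy := (hasDerivAt_quantile hy).comp r ly
  have k1 := ((hasDerivAt_cdf _).comp r ((qy.sub (qx.const_mul ρ)).div_const (sd ρ))).const_mul a
  have k2 := ((hasDerivAt_cdf _).comp r ((qx.sub (qy.const_mul ρ)).div_const (sd ρ))).const_mul b
  refine (k1.add k2).congr_deriv ?_
  simp only [Function.comp, lineDeriv₂, density, Pi.sub_apply]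
  have p1 := (pdf_pos (quantile (x + r * a))).ne'
  have p2 := (pdf_pos (quantile (y + r * b))).ne'
  have hσ := (sd_pos h0 h1).ne'
  have hsym := pdf_mul_pdf h0 h1 (quantile (x + r * a)) (quantile (y + r * b))
  set s := quantile (x + r * a)
  set t := quantile (y + r * b)
  -- The symmetry of the joint density lets both terms be expressed through the single function
  -- `density`.
  have hsym' : pdf ((s - ρ * t) / sd ρ) = pdf s * pdf ((t - ρ * s) / sd ρ) / pdf t := by
    rw [eq_div_iff p2, hsym, mul_comm]
  rw [hsym']
  field_simp
  ring

theorem contDiffOn_density {ρ : ℝ} : ContDiffOn ℝ 1 (density ρ) (Ioo 0 1 ×ˢ Ioo 0 1) := by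
  have q1 : ContDiffOn ℝ 1 (fun p : ℝ × ℝ => quantile p.1) (Ioo 0 1 ×ˢ Ioo 0 1) :=
    contDiffOn_quantile.comp contDiffOn_fst fun p hp => hp.1
  have q2 : ContDiffOn ℝ 1 (fun p : ℝ × ℝ => quantile p.2) (Ioo 0 1 ×ˢ Ioo 0 1) :=
    contDiffOn_quantile.comp contDiffOn_snd fun p hp => hp.2
  exact ((contDiff_pdf.comp_contDiffOn q1).mul (contDiff_pdf.comp_contDiffOn
    ((q2.sub (contDiffOn_const.mul q1)).div_const _))).div_const _

theorem contDiffOn_inv_pdf_quantile : ContDiffOn ℝ 1 (fun x => (pdf (quantile x))⁻¹) (Ioo 0 1) :=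
  (contDiff_pdf.comp_contDiffOn contDiffOn_quantile).inv fun _ _ => (pdf_pos _).ne'

/-- The Hessian of `stabFun` is Lipschitz on compact boxes in the open unit square. -/
theorem exists_lineDeriv₂_sub_le (h0 : 0 ≤ ρ) (h1 : ρ < 1) {δ : ℝ} (hδ : 0 < δ) :
    ∃ L : ℝ, 0 ≤ L ∧ ∀ a b, ∀ x ∈ Icc δ (1 - δ), ∀ y ∈ Icc δ (1 - δ), ∀ x' ∈ Icc δ (1 - δ),
      ∀ y' ∈ Icc δ (1 - δ), lineDeriv₂ ρ a b x y - lineDeriv₂ ρ a b x' y' ≤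
        L * (|a| + |b|) ^ 2 * (|x - x'| + |y - y'|) := by
  have hsub : Icc δ (1 - δ) ⊆ Ioo (0 : ℝ) 1 := fun z hz => ⟨by linarith [hz.1], by linarith [hz.2]⟩
  set Q : Set (ℝ × ℝ) := Icc δ (1 - δ) ×ˢ Icc δ (1 - δ)
  have hQ : Q ⊆ Ioo 0 1 ×ˢ Ioo 0 1 := prod_mono hsub hsub
  have hconv : Convex ℝ Q := (convex_Icc _ _).prod (convex_Icc _ _)
  have hcomp : IsCompact Q := isCompact_Icc.prod isCompact_Icc
  have i1 : ContDiffOn ℝ 1 (fun p : ℝ × ℝ => (pdf (quantile p.1))⁻¹) Q :=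
    contDiffOn_inv_pdf_quantile.comp contDiffOn_fst fun p hp => (hQ hp).1
  have i2 : ContDiffOn ℝ 1 (fun p : ℝ × ℝ => (pdf (quantile p.2))⁻¹) Q :=
    contDiffOn_inv_pdf_quantile.comp contDiffOn_snd fun p hp => (hQ hp).2
  have hd : ContDiffOn ℝ 1 (density ρ) Q := contDiffOn_density.mono hQ
  -- The coefficients of ab, a² and b² are C¹ on a compact convex box, hence Lipschitz there. They
  -- need not be bounded near the boundary of the unit square, which is why values are kept in [δ, 1
  -- - δ].
  obtain ⟨L₁, e₁⟩ := ((hd.mul i1).mul i2).exists_lipschitzOnWith one_ne_zero hconv hcomp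
  obtain ⟨L₂, e₂⟩ := ((hd.mul i1).mul i1).exists_lipschitzOnWith one_ne_zero hconv hcomp
  obtain ⟨L₃, e₃⟩ := ((hd.mul i2).mul i2).exists_lipschitzOnWith one_ne_zero hconv hcomp
  refine ⟨(L₁ : ℝ) + L₂ + L₃, by positivity, fun a b x hx y hy x' hx' y' hy' => ?_⟩
  have m : (x, y) ∈ Q := ⟨hx, hy⟩
  have m' : (x', y') ∈ Q := ⟨hx', hy'⟩
  set D := |x - x'| + |y - y'| with hD
  have hD0 : 0 ≤ D := by positivity
  have hdist : dist (x, y) (x', y') ≤ D := by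
    rw [Prod.dist_eq, Real.dist_eq, Real.dist_eq]
    exact max_le (le_add_of_nonneg_right (abs_nonneg _)) (le_add_of_nonneg_left (abs_nonneg _))
  have f₁ := (e₁.dist_le_mul _ m _ m').trans (mul_le_mul_of_nonneg_left hdist L₁.2)
  have f₂ := (e₂.dist_le_mul _ m _ m').trans (mul_le_mul_of_nonneg_left hdist L₂.2)
  have f₃ := (e₃.dist_le_mul _ m _ m').trans (mul_le_mul_of_nonneg_left hdist L₃.2)
  rw [Real.dist_eq] at f₁ f₂ f₃
  simp only at f₁ f₂ f₃
  have step : ∀ c w w' l : ℝ, |w - w'| ≤ l * D → |c| ≤ (|a| + |b|) ^ 2 →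
      c * (w - w') ≤ (|a| + |b|) ^ 2 * (l * D) := fun c w w' l hw hc =>
    (le_abs_self _).trans (by rw [abs_mul]; gcongr)
  have ha := abs_nonneg a
  have hb := abs_nonneg b
  have s₁ := step (2 * (a * b)) _ _ _ f₁ (by
    rw [abs_mul, abs_mul, abs_two]; nlinarith [sq_nonneg |a|, sq_nonneg |b|])
  have s₂ := step (-(ρ * a ^ 2)) _ _ _ f₂ (by
    rw [abs_neg, abs_mul, abs_of_nonneg h0, abs_of_nonneg (sq_nonneg a), ← sq_abs a]
    nlinarith [sq_nonneg |a|, sq_nonneg |b|, mul_nonneg ha hb])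
  have s₃ := step (-(ρ * b ^ 2)) _ _ _ f₃ (by
    rw [abs_neg, abs_mul, abs_of_nonneg h0, abs_of_nonneg (sq_nonneg b), ← sq_abs b]
    nlinarith [sq_nonneg |a|, sq_nonneg |b|, mul_nonneg ha hb])
  simp only [lineDeriv₂]
  linear_combination s₁ + s₂ + s₃

/-- The mean value theorem twice; the sharper constant C/2 is not needed. -/
theorem le_add_of_second_deriv_le {G G' G'' : ℝ → ℝ} {C : ℝ} (hC : 0 ≤ C)
    (h1 : ∀ r ∈ Icc (0 : ℝ) 1, HasDerivAt G (G' r) r)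
    (h2 : ∀ r ∈ Icc (0 : ℝ) 1, HasDerivAt G' (G'' r) r) (h3 : G' 0 = 0)
    (h4 : ∀ r ∈ Icc (0 : ℝ) 1, G'' r ≤ C) : G 1 ≤ G 0 + C := by
  obtain ⟨ξ, hξ, e1⟩ := exists_hasDerivAt_eq_slope G G' zero_lt_one
    (fun r hr => (h1 r hr).continuousAt.continuousWithinAt)
    fun r hr => h1 r (Ioo_subset_Icc_self hr)
  obtain ⟨ζ, hζ, e2⟩ := exists_hasDerivAt_eq_slope G' G'' hξ.1
    (fun r hr => (h2 r ⟨hr.1, hr.2.trans hξ.2.le⟩).continuousAt.continuousWithinAt)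
    fun r hr => h2 r ⟨hr.1.le, (hr.2.trans hξ.2).le⟩
  have h5 := h4 ζ ⟨hζ.1.le, (hζ.2.trans hξ.2).le⟩
  rw [e2, h3, sub_zero, sub_zero, div_le_iff₀ hξ.1] at h5
  rw [sub_zero, div_one] at e1
  nlinarith [hξ.1, hξ.2]

/-- At a single correlated pair of signs, the Hessian of `stabFun` is seminegative. -/
theorem lineDeriv₂_average_nonpos (h0 : 0 ≤ ρ) (h1 : ρ < 1) (c d x y : ℝ) :
    (1 + ρ) / 4 * (lineDeriv₂ ρ c d x y + lineDeriv₂ ρ (-c) (-d) x y) +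
      (1 - ρ) / 4 * (lineDeriv₂ ρ c (-d) x y + lineDeriv₂ ρ (-c) d x y) ≤ 0 := by
  have hw : 0 ≤ density ρ (x, y) :=
    div_nonneg (mul_nonneg (pdf_pos _).le (pdf_pos _).le) (sd_pos h0 h1).le
  -- The product of the two signs has mean `ρ`, so the cross term 2ab becomes 2ρcd. The average is
  -- then exactly -ρ · density · (c / pdf(q(x)) - d / pdf(q(y)))², with q the quantile function.
  have key := mul_nonneg (mul_nonneg h0 hw)
    (sq_nonneg (c * (pdf (quantile x))⁻¹ - d * (pdf (quantile y))⁻¹))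
  simp only [lineDeriv₂]
  linear_combination key

/-- The two-point inequality for `stabFun`, with a cubic error term. -/
theorem exists_stabFun_two_point (h0 : 0 ≤ ρ) (h1 : ρ < 1) {δ : ℝ} (hδ : 0 < δ) :
    ∃ M : ℝ, 0 ≤ M ∧ ∀ x y c d, x + c ∈ Icc δ (1 - δ) → x - c ∈ Icc δ (1 - δ) →
      y + d ∈ Icc δ (1 - δ) → y - d ∈ Icc δ (1 - δ) →
      (1 + ρ) / 4 * (stabFun ρ (x + c) (y + d) + stabFun ρ (x - c) (y - d)) +
        (1 - ρ) / 4 * (stabFun ρ (x + c) (y - d) + stabFun ρ (x - c) (y + d)) ≤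
      stabFun ρ x y + (M * |c| ^ 3 + M * |d| ^ 3) := by
  obtain ⟨L, hL, hlip⟩ := exists_lineDeriv₂_sub_le h0 h1 hδ
  refine ⟨4 * L, by positivity, fun x y c d hx1 hx2 hy1 hy2 => ?_⟩
  have hsub : Icc δ (1 - δ) ⊆ Ioo (0 : ℝ) 1 := fun z hz => ⟨by linarith [hz.1], by linarith [hz.2]⟩
  have mem : ∀ z w, z + w ∈ Icc δ (1 - δ) → z - w ∈ Icc δ (1 - δ) → ∀ r ∈ Icc (0 : ℝ) 1,
      z + r * w ∈ Icc δ (1 - δ) ∧ z + r * -w ∈ Icc δ (1 - δ) := by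
    rintro z w ⟨p1, p2⟩ ⟨p3, p4⟩ r ⟨r1, r2⟩
    refine ⟨⟨?_, ?_⟩, ⟨?_, ?_⟩⟩ <;> nlinarith
  have mx := mem x c hx1 hx2
  have my := mem y d hy1 hy2
  have m0x := (mx 0 ⟨le_rfl, zero_le_one⟩).1
  have m0y := (my 0 ⟨le_rfl, zero_le_one⟩).1
  rw [zero_mul, add_zero] at m0x m0y
  -- The average over the four sign choices, along segments from (x, y) at r = 0 to the displaced
  -- points at r = 1.
  set avg : (ℝ → ℝ → ℝ → ℝ) → ℝ → ℝ := fun H r =>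
    (1 + ρ) / 4 * (H c d r + H (-c) (-d) r) + (1 - ρ) / 4 * (H c (-d) r + H (-c) d r) with havg
  have davg : ∀ (H H' : ℝ → ℝ → ℝ → ℝ) (r : ℝ), HasDerivAt (H c d) (H' c d r) r →
      HasDerivAt (H (-c) (-d)) (H' (-c) (-d) r) r → HasDerivAt (H c (-d)) (H' c (-d) r) r →
      HasDerivAt (H (-c) d) (H' (-c) d r) r → HasDerivAt (avg H) (avg H' r) r :=
    fun H H' r k1 k2 k3 k4 => ((k1.add k2).const_mul _).add ((k3.add k4).const_mul _)
  set C := L * (|c| + |d|) ^ 3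
  have hC : 0 ≤ C := by positivity
  have main := le_add_of_second_deriv_le (C := C) hC
    (G := avg fun a b r => stabFun ρ (x + r * a) (y + r * b))
    (G' := avg fun a b r => lineDeriv₁ ρ a b (x + r * a) (y + r * b))
    (G'' := avg fun a b r => lineDeriv₂ ρ a b (x + r * a) (y + r * b))
    (fun r hr => davg (fun a b r => stabFun ρ (x + r * a) (y + r * b))
      (fun a b r => lineDeriv₁ ρ a b (x + r * a) (y + r * b)) r
      (hasDerivAt_stabFun_line h0 h1 (hsub (mx r hr).1) (hsub (my r hr).1))
      (hasDerivAt_stabFun_line h0 h1 (hsub (mx r hr).2) (hsub (my r hr).2))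
      (hasDerivAt_stabFun_line h0 h1 (hsub (mx r hr).1) (hsub (my r hr).2))
      (hasDerivAt_stabFun_line h0 h1 (hsub (mx r hr).2) (hsub (my r hr).1)))
    (fun r hr => davg (fun a b r => lineDeriv₁ ρ a b (x + r * a) (y + r * b))
      (fun a b r => lineDeriv₂ ρ a b (x + r * a) (y + r * b)) r
      (hasDerivAt_lineDeriv₁ h0 h1 (hsub (mx r hr).1) (hsub (my r hr).1))
      (hasDerivAt_lineDeriv₁ h0 h1 (hsub (mx r hr).2) (hsub (my r hr).2))
      (hasDerivAt_lineDeriv₁ h0 h1 (hsub (mx r hr).1) (hsub (my r hr).2))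
      (hasDerivAt_lineDeriv₁ h0 h1 (hsub (mx r hr).2) (hsub (my r hr).1)))
    -- The first derivative is odd in the direction, and opposite directions have equal weight.
    (by simp only [havg, lineDeriv₁]; ring_nf)
    (by
      intro r hr
      have hbase := lineDeriv₂_average_nonpos h0 h1 c d x y
      -- Moving the Hessian to the base point costs its Lipschitz constant times the displacement r
      -- (|c| + |d|), on top of the quadratic factor. This is the source of the cubic error.
      have lip : ∀ a b, |a| = |c| → |b| = |d| → x + r * a ∈ Icc δ (1 - δ) →
          y + r * b ∈ Icc δ (1 - δ) →
          lineDeriv₂ ρ a b (x + r * a) (y + r * b) ≤ lineDeriv₂ ρ a b x y + C := by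
        intro a b ha hb h3 h4
        have h5 := hlip a b _ h3 _ h4 _ m0x _ m0y
        rw [add_sub_cancel_left, add_sub_cancel_left, abs_mul, abs_mul, ha, hb,
          abs_of_nonneg hr.1, ← mul_add] at h5
        have h6 : L * (|c| + |d|) ^ 2 * (r * (|c| + |d|)) ≤ C := by
          calc _ = r * C := by ring
            _ ≤ C := mul_le_of_le_one_left hC hr.2
        linarith
      have k1 := lip c d rfl rfl (mx r hr).1 (my r hr).1
      have k2 := lip (-c) (-d) (abs_neg c) (abs_neg d) (mx r hr).2 (my r hr).2
      have k3 := lip c (-d) rfl (abs_neg d) (mx r hr).1 (my r hr).2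
      have k4 := lip (-c) d (abs_neg c) rfl (mx r hr).2 (my r hr).1
      have w1 : 0 ≤ (1 + ρ) / 4 := by linarith
      have w2 : 0 ≤ (1 - ρ) / 4 := by linarith
      simp only [havg]
      linear_combination mul_le_mul_of_nonneg_left k1 w1 + mul_le_mul_of_nonneg_left k2 w1 +
        mul_le_mul_of_nonneg_left k3 w2 + mul_le_mul_of_nonneg_left k4 w2 + hbase)
  simp only [havg, one_mul, zero_mul, add_zero, ← sub_eq_add_neg] at main
  have hcube : (|c| + |d|) ^ 3 ≤ 4 * (|c| ^ 3 + |d| ^ 3) := by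
    have ha := abs_nonneg c
    have hb := abs_nonneg d
    nlinarith [mul_nonneg (add_nonneg ha hb) (sq_nonneg (|c| - |d|))]
  have := mul_le_mul_of_nonneg_left hcube hL
  simp only [C] at main
  linarith

end

end GaussianStability

/-! ### Assembly: smoothing, rescaling and the error function. -/

namespace BooleanCube

noncomputable section

variable {n : ℕ}

open GaussianStability

/-! ### Majority is stablest -/

theorem stab_affine (ρ a b : ℝ) {g : Cube n → ℝ} (hg : mean g = 0) :
    stab ρ (fun x => a + b * g x) = a ^ 2 + b ^ 2 * stab ρ g := by
  have h1 : ∀ x, noiseOp ρ (fun x => a + b * g x) x = a + b * noiseOp ρ g x := fun x => by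
    rw [noiseOp_add ρ (fun _ => a), noiseOp_const, noiseOp_const_mul]
  have h2 : (fun x => (a + b * g x) * (a + b * noiseOp ρ g x)) = fun x =>
      a ^ 2 + ((a * b) * g x + ((a * b) * noiseOp ρ g x + b ^ 2 * (g x * noiseOp ρ g x))) := by
    funext x; ring
  simp only [stab, h1]
  rw [h2, mean_add (fun _ => a ^ 2), mean_const, mean_add, mean_const_mul, mean_add, mean_const_mul,
    mean_const_mul, mean_noiseOp, hg]
  ring

/-- For a `[δ, 1 - δ]`-valued function of mean one half, the noise stability exceeds that of a
Gaussian half-space by at most the total third moment of the derivatives. -/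
theorem exists_stab_le_gaussian {ρ δ : ℝ} (h0 : 0 ≤ ρ) (h1 : ρ < 1) (hδ : 0 < δ) :
    ∃ M : ℝ, 0 ≤ M ∧ ∀ (n : ℕ) (F : Cube n → ℝ), (∀ x, F x ∈ Set.Icc δ (1 - δ)) →
      mean F = 1 / 2 →
      stab ρ F ≤ 1 / 4 + Real.arcsin ρ / (2 * Real.pi) +
        M * ∑ i, mean (fun x => |discreteDeriv i F x| ^ 3) := by
  obtain ⟨M, hM, two⟩ := exists_stabFun_two_point h0 h1 hδ
  refine ⟨2 * M, by positivity, fun n F hF hmean => ?_⟩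
  have hsub : Set.Icc δ (1 - δ) ⊆ Set.Ioo (0 : ℝ) 1 := fun z hz =>
    ⟨by linarith [hz.1], by linarith [hz.2]⟩
  have hconv : ∀ p q : ℝ, M * |(p + q) / 2| ^ 3 ≤ (M * |p| ^ 3 + M * |q| ^ 3) / 2 := by
    intro p q
    have hp := abs_nonneg p
    have hq := abs_nonneg q
    have h2 : |(p + q) / 2| ^ 3 ≤ ((|p| + |q|) / 2) ^ 3 := by
      rw [abs_div, abs_two]; gcongr; exact abs_add_le p q
    have h3 : ((|p| + |q|) / 2) ^ 3 ≤ (|p| ^ 3 + |q| ^ 3) / 2 := by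
      nlinarith [mul_nonneg (add_nonneg hp hq) (sq_nonneg (|p| - |q|))]
    calc M * |(p + q) / 2| ^ 3 ≤ M * ((|p| ^ 3 + |q| ^ 3) / 2) := by gcongr; exact h2.trans h3
      _ = _ := by ring
  have hB := pairMean_le_of_two_point (B := stabFun ρ) (e := fun c => M * |c| ^ 3)
    (by linarith) h1.le hconv two F F hF hF
  rw [hmean, stabFun_half h0 h1] at hB
  simp only [mean_const_mul, ← Finset.mul_sum] at hB
  -- Only here is positive correlation of half-lines used: xy ≤ J(x, y) replaces the product by J.
  have hlow : stab ρ F ≤ pairMean ρ (fun x y => stabFun ρ (F x) (F y)) := by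
    rw [stab, ← pairMean_mul]
    exact pairMean_mono (by linarith) h1.le fun x y =>
      mul_le_stabFun h0 h1 (hsub (hF x)) (hsub (hF y))
  linarith

/-- Two smoothings by `s`, acting on both arguments of the stability, multiply the correlation by
s⁴. Starting from ρ / s⁴ compensates, and continuity of arcsin controls the loss as s tends to 1
from below. -/
theorem exists_smoothing {ρ κ : ℝ} (h1 : ρ < 1) (hκ : 0 < κ) :
    ∃ s : ℝ, 0 < s ∧ s < 1 ∧ ρ / s ^ 4 < 1 ∧
      2 / Real.pi * Real.arcsin (ρ / s ^ 4) < 2 / Real.pi * Real.arcsin ρ + κ := by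
  have hc : ContinuousAt (fun s : ℝ => ρ / s ^ 4) 1 :=
    continuousAt_const.div (by fun_prop) (by norm_num)
  have e1 : ∀ᶠ s in 𝓝[<] (1 : ℝ), ρ / s ^ 4 < 1 :=
    (hc.eventually_lt continuousAt_const (by simpa using h1)).filter_mono nhdsWithin_le_nhds
  have e2 : ∀ᶠ s in 𝓝[<] (1 : ℝ),
      2 / Real.pi * Real.arcsin (ρ / s ^ 4) < 2 / Real.pi * Real.arcsin ρ + κ := by
    refine Filter.Eventually.filter_mono nhdsWithin_le_nhds (ContinuousAt.eventually_lt
      (((Real.continuous_arcsin.continuousAt).comp hc).const_mul _) continuousAt_const ?_)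
    simpa using hκ
  have e3 : ∀ᶠ s in 𝓝[<] (1 : ℝ), 0 < s :=
    (lt_mem_nhds zero_lt_one).filter_mono nhdsWithin_le_nhds
  obtain ⟨s, ⟨⟨hs1, hs2⟩, hs3⟩, hs4⟩ :=
    (((e1.and e2).and e3).and self_mem_nhdsWithin).exists
  exact ⟨s, hs3, hs4, hs1, hs2⟩

theorem one_sub_arccos (ρ : ℝ) :
    1 - 2 / Real.pi * Real.arccos ρ = 2 / Real.pi * Real.arcsin ρ := by
  have := Real.pi_pos
  rw [Real.arccos]
  field_simp
  ring

theorem exists_stab_le {ρ κ : ℝ} (h0 : 0 < ρ) (h1 : ρ < 1) (hκ : 0 < κ) :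
    ∃ ε > 0, ∀ (n : ℕ) (f : Cube n → ℝ), (∀ x, f x ∈ Set.Icc (-1 : ℝ) 1) → mean f = 0 →
      (∀ i, influence i f ≤ ε) → stab ρ f ≤ 1 - 2 / Real.pi * Real.arccos ρ + κ := by
  obtain ⟨s, hs0, hs1, hρ1, hclose⟩ := exists_smoothing h1 (show 0 < κ / 3 by linarith)
  have hρ0 : 0 ≤ ρ / s ^ 4 := by positivity
  -- The error budget is κ/3 each for the change of correlation, for four times the derivative error
  -- κ/12, and for the factor (1 - 2δ)² ≥ 1 - 4δ coming from the affine map into [δ, 1 - δ].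
  set δ := min (1 / 4) (κ / 12)
  have hδ : 0 < δ := lt_min (by norm_num) (by linarith)
  have hδ1 : δ ≤ 1 / 4 := min_le_left _ _
  have hδ2 : δ ≤ κ / 12 := min_le_right _ _
  obtain ⟨M, hM, hstab⟩ := exists_stab_le_gaussian hρ0 hρ1 hδ
  obtain ⟨ε, hε, hsmall⟩ :=
    -- `M + 1` instead of `M` because `M` may vanish.
    exists_sum_mean_abs_deriv_cube_le hs0 hs1 (show 0 < κ / (12 * (M + 1)) by positivity)
  refine ⟨ε, hε, fun n f hf hmean hinf => ?_⟩
  set g := noiseOp s (noiseOp s f) with hg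
  have hgI : ∀ x, g x ∈ Set.Icc (-1 : ℝ) 1 :=
    noiseOp_mem_Icc (by linarith) hs1.le (noiseOp_mem_Icc (by linarith) hs1.le hf)
  have hg0 : mean g = 0 := by rw [hg, mean_noiseOp, mean_noiseOp, hmean]
  have hgs : stab (ρ / s ^ 4) g = stab ρ f := by
    rw [hg, stab_noiseOp, stab_noiseOp]
    congr 1
    field_simp
  have hF := hstab n (fun x => 1 / 2 + (1 - 2 * δ) / 2 * g x)
    (fun x => by constructor <;> nlinarith [(hgI x).1, (hgI x).2])
    (by rw [mean_add (fun _ => (1 / 2 : ℝ)), mean_const, mean_const_mul, hg0]; ring)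
  rw [stab_affine _ _ _ hg0, hgs] at hF
  have hder : ∑ i, mean (fun x => |discreteDeriv i (fun x => 1 / 2 + (1 - 2 * δ) / 2 * g x) x| ^ 3) ≤
      κ / (12 * (M + 1)) := by
    refine le_trans (Finset.sum_le_sum fun i _ => mean_mono fun x => ?_) (hsmall n f hf hinf)
    have h2 : discreteDeriv i (fun x => 1 / 2 + (1 - 2 * δ) / 2 * g x) x =
        (1 - 2 * δ) / 2 * discreteDeriv i g x := by
      simp only [discreteDeriv]; ring
    rw [h2, abs_mul]
    gcongr
    refine mul_le_of_le_one_left (abs_nonneg _) ?_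
    rw [abs_le]
    constructor <;> linarith
  have herr : M * ∑ i, mean (fun x =>
      |discreteDeriv i (fun x => 1 / 2 + (1 - 2 * δ) / 2 * g x) x| ^ 3) ≤ κ / 12 := by
    calc _ ≤ M * (κ / (12 * (M + 1))) := by gcongr
      _ ≤ (M + 1) * (κ / (12 * (M + 1))) := by gcongr; linarith
      _ = κ / 12 := by field_simp
  have hle : (1 - 2 * δ) ^ 2 * stab ρ f ≤ 2 / Real.pi * Real.arcsin (ρ / s ^ 4) + κ / 3 := by
    have e : 2 / Real.pi * Real.arcsin (ρ / s ^ 4) =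
        4 * (Real.arcsin (ρ / s ^ 4) / (2 * Real.pi)) := by
      have := Real.pi_pos
      field_simp
      ring
    rw [e]
    linarith
  have h2 := stab_le_one (by linarith) h1.le hf
  have h3 := stab_nonneg h0.le f
  have h4 : 4 * δ * stab ρ f ≤ 4 * δ := mul_le_of_le_one_right (by positivity) h2
  have h5 : 0 ≤ 4 * δ ^ 2 * stab ρ f := by positivity
  rw [one_sub_arccos]
  linarith

/-- Turns "for every κ there is a threshold ε₀" into one error function, namely the least
nonnegative upper bound of `V ε`. The uniform bound `b` makes the set of bounds nonempty, so that
its infimum is meaningful. -/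
theorem exists_error_function {V : ℝ → Set ℝ} {b : ℝ} (hb : ∀ ε, ∀ v ∈ V ε, v ≤ b)
    (hV : ∀ κ > 0, ∃ ε₀ > 0, ∀ ε ≤ ε₀, ∀ v ∈ V ε, v ≤ κ) :
    ∃ err : ℝ → ℝ, Tendsto err (𝓝[>] 0) (𝓝 0) ∧ ∀ ε, ∀ v ∈ V ε, v ≤ err ε := by
  have hne : ∀ ε, {κ : ℝ | 0 ≤ κ ∧ ∀ v ∈ V ε, v ≤ κ}.Nonempty := fun ε =>
    ⟨max 0 b, le_max_left _ _, fun v hv => (hb ε v hv).trans (le_max_right _ _)⟩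
  refine ⟨fun ε => sInf {κ : ℝ | 0 ≤ κ ∧ ∀ v ∈ V ε, v ≤ κ}, ?_,
    fun ε v hv => le_csInf (hne ε) fun κ hκ => hκ.2 v hv⟩
  rw [Metric.tendsto_nhds]
  intro κ hκ
  obtain ⟨ε₀, hε₀, h⟩ := hV (κ / 2) (by linarith)
  filter_upwards [(gt_mem_nhds hε₀).filter_mono nhdsWithin_le_nhds] with ε hε
  have h1 : sInf {κ : ℝ | 0 ≤ κ ∧ ∀ v ∈ V ε, v ≤ κ} ≤ κ / 2 :=
    csInf_le ⟨0, fun _ hx => hx.1⟩ ⟨by linarith, h ε hε.le⟩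
  have h2 : 0 ≤ sInf {κ : ℝ | 0 ≤ κ ∧ ∀ v ∈ V ε, v ≤ κ} := Real.sInf_nonneg fun _ hx => hx.1
  rw [Real.dist_eq, sub_zero, abs_of_nonneg h2]
  linarith

theorem exists_error_stab_le {ρ : ℝ} (h0 : 0 < ρ) (h1 : ρ < 1) :
    ∃ err : ℝ → ℝ, Tendsto err (𝓝[>] 0) (𝓝 0) ∧
      ∀ (ε : ℝ) (n : ℕ) (f : Cube n → ℝ), (∀ x, f x ∈ Set.Icc (-1 : ℝ) 1) → mean f = 0 →
        (∀ i, influence i f ≤ ε) → stab ρ f ≤ 1 - 2 / Real.pi * Real.arccos ρ + err ε := by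
  obtain ⟨err, herr, h⟩ := exists_error_function
    (V := fun ε => {v | ∃ (n : ℕ) (f : Cube n → ℝ), (∀ x, f x ∈ Set.Icc (-1 : ℝ) 1) ∧
      mean f = 0 ∧ (∀ i, influence i f ≤ ε) ∧ v = stab ρ f - (1 - 2 / Real.pi * Real.arccos ρ)})
    (b := 1 - (1 - 2 / Real.pi * Real.arccos ρ))
    (by
      rintro ε v ⟨n, f, hf, -, -, rfl⟩
      linarith [stab_le_one (by linarith) h1.le hf])
    (by
      intro κ hκ
      obtain ⟨ε₀, hε₀, h⟩ := exists_stab_le h0 h1 hκ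
      refine ⟨ε₀, hε₀, ?_⟩
      rintro ε hε v ⟨n, f, hf, hm, hi, rfl⟩
      linarith [h n f hf hm fun i => (hi i).trans hε])
  refine ⟨err, herr, fun ε n f hf hm hi => ?_⟩
  linarith [h ε _ ⟨n, f, hf, hm, hi, rfl⟩]

end

end BooleanCube

/-- In both parts the error function `err` may depend on `ρ` only; that it tends to `0` as
`ε → 0⁺` is the meaning of `o_ε(1)`. -/
theorem mainTheorem2 :
    (∀ ρ : ℝ, 0 < ρ → ρ < 1 →
      ∃ err : ℝ → ℝ, Tendsto err (𝓝[>] 0) (𝓝 0) ∧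
        ∀ ε : ℝ, 0 < ε → ∀ (n : ℕ) (f : BooleanCube.Cube n → ℝ),
          (∀ x, f x ∈ Set.Icc (-1 : ℝ) 1) →
          BooleanCube.mean f = 0 →
          (∀ i, BooleanCube.influence i f ≤ ε) →
          BooleanCube.stab ρ f ≤ 1 - 2 / Real.pi * Real.arccos ρ + err ε) ∧
    (∀ ρ : ℝ, -1 < ρ → ρ < 0 →
      ∃ err : ℝ → ℝ, Tendsto err (𝓝[>] 0) (𝓝 0) ∧
        ∀ ε : ℝ, 0 < ε → ∀ (n : ℕ) (f : BooleanCube.Cube n → ℝ),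
          (∀ x, f x ∈ Set.Icc (-1 : ℝ) 1) →
          (∀ i, BooleanCube.influence i f ≤ ε) →
          1 - 2 / Real.pi * Real.arccos ρ + err ε ≤ BooleanCube.stab ρ f) := by
  refine ⟨fun ρ h0 h1 => ?_, fun ρ h1 h0 => ?_⟩
  · obtain ⟨err, herr, h⟩ := BooleanCube.exists_error_stab_le h0 h1
    exact ⟨err, herr, fun ε _ n f hf hm hi => h ε n f hf hm hi⟩
  · obtain ⟨err, herr, h⟩ := BooleanCube.exists_error_stab_le (ρ := -ρ) (by linarith) (by linarith)
    refine ⟨fun ε => -err ε, by simpa using herr.neg, fun ε _ n f hf hi => ?_⟩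
    -- Passing to the antisymmetric part supplies the mean-zero hypothesis without increasing any
    -- influence; oddness of arcsin then matches the two bounds.
    have h2 := h ε n (BooleanCube.antisymm f) (BooleanCube.antisymm_mem_Icc hf)
      (BooleanCube.mean_antisymm f) fun i => (BooleanCube.influence_antisymm_le i f).trans (hi i)
    have h3 := BooleanCube.neg_stab_antisymm_le (ρ := -ρ) (by linarith) f
    rw [neg_neg] at h3
    rw [BooleanCube.one_sub_arccos, Real.arcsin_neg] at h2
    rw [BooleanCube.one_sub_arccos]
    linarith
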